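/- Let $\alpha\in\mathbb Q\setminus\{0,1,-1\}$, and let $C_\alpha$ be the projective curve over $\mathbb Q$ given by \[ C_\alpha:\quad y^2=\alpha^2x^4-(1+\alpha^2)^2x^2+4\alpha^2 , \] that is, the curve $y^2=\alpha^2x^4-(1+\alpha^2)^2x^2z^2+4\alpha^2z^4$ in the weighted projective plane $\mathbb P(1,2,1)$ with coordinates $x,y,z$. Then $C_\alpha$ is smooth and, with the rational point $(x,y)=(0,2\alpha)$ as origin, it is an elliptic curve over $\mathbb Q$ of positive Mordell--Weil rank. More precisely, the Weierstrass equation \[ C'_\alpha:\quad y^2=x^3-27\bigl(48\alpha^4+(1+\alpha^2)^4\bigr)x-54(1+\alpha^2)^2\bigl((1+\alpha^2)^4-144\alpha^4\bigr) \] defines an elliptic curve over $\mathbb Q$; there is an isomorphism of curves $C_\alpha\to C'_\alpha$ over $\mathbb Q$ that sends $(0,2\alpha)$ to the point at infinity; the group $C_\alpha(\mathbb Q)$ (with the group law carried over by this isomorphism) has positive rank; and the point $(X,Y)$ with \begin{align*} X&=\frac{3}{4\alpha^4}(1+\alpha^2)^2\left(3+12\alpha^2-22\alpha^4+12\alpha^6+3\alpha^8\right),\\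 Y&=\frac{27}{8\alpha^6}(-1+\alpha^2)^2\left(1+11\alpha^2+37\alpha^4+47\alpha^6+47\alpha^8+37\alpha^{10}+11\alpha^{12}+\alpha^{14}\right) \end{align*} lies on $C'_\alpha$ and has infinite order in $C'_\alpha(\mathbb Q)$. -/

import Mathlib

open scoped WeierstrassCurve

/-- The coefficients of a curve `y² = a x⁴ + b x³ + c x² + d x + e` over `ℚ`.  The curve meant is the
usual projective model, i.e. `y² = a x⁴ + b x³ z + c x² z² + d x z³ + e z⁴` in the weighted projective
plane `ℙ(1, 2, 1)`; it is covered by the affine curve `z = 1` and by the affine curve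
`v² = a + b u + c u² + d u³ + e u⁴` (`x = 1`), glued along `u = 1 / x`, `v = y / x²`. -/
@[ext]
structure QuarticCurve where
  (a b c d e : ℚ)

namespace QuarticCurve

/-- The points of the projective model over an extension `K` of `ℚ`: the affine solutions `(x, y)`
and the points at infinity `[1 : v : 0]`, where `v² = a`. -/
inductive Point (Q : QuarticCurve) (K : Type) [Field K] [Algebra ℚ K] : Type
  | affine (x y : K) (h : y ^ 2 = algebraMap ℚ K Q.a * x ^ 4 + algebraMap ℚ K Q.b * x ^ 3 +
      algebraMap ℚ K Q.c * x ^ 2 + algebraMap ℚ K Q.d * x + algebraMap ℚ K Q.e)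
  | infinity (v : K) (h : v ^ 2 = algebraMap ℚ K Q.a)

/-- Homogeneous coordinates of a point in the weighted projective plane `ℙ(1, 2, 1)`. -/
def Point.coords {Q : QuarticCurve} {K : Type} [Field K] [Algebra ℚ K] : Q.Point K → Fin 3 → K
  | .affine x y _ => ![x, y, 1]
  | .infinity v _ => ![1, v, 0]

/-- The projective model is smooth over `ℚ`: in both affine charts the two partial derivatives
have no common zero on the curve, over any extension field of `ℚ`. -/
def IsSmooth (Q : QuarticCurve) : Prop :=
  ∀ (K : Type) [Field K] [Algebra ℚ K],
    (∀ x y : K, y ^ 2 = algebraMap ℚ K Q.a * x ^ 4 + algebraMap ℚ K Q.b * x ^ 3 +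
        algebraMap ℚ K Q.c * x ^ 2 + algebraMap ℚ K Q.d * x + algebraMap ℚ K Q.e →
      2 * y ≠ 0 ∨ 4 * algebraMap ℚ K Q.a * x ^ 3 + 3 * algebraMap ℚ K Q.b * x ^ 2 +
        2 * algebraMap ℚ K Q.c * x + algebraMap ℚ K Q.d ≠ 0) ∧
    (∀ u v : K, v ^ 2 = algebraMap ℚ K Q.a + algebraMap ℚ K Q.b * u +
        algebraMap ℚ K Q.c * u ^ 2 + algebraMap ℚ K Q.d * u ^ 3 + algebraMap ℚ K Q.e * u ^ 4 →
      2 * v ≠ 0 ∨ algebraMap ℚ K Q.b + 2 * algebraMap ℚ K Q.c * u +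
        3 * algebraMap ℚ K Q.d * u ^ 2 + 4 * algebraMap ℚ K Q.e * u ^ 3 ≠ 0)

end QuarticCurve

/-- Homogeneous coordinates in `ℙ²` of a point of a Weierstrass curve. -/
def WeierstrassCurve.projCoords {K : Type} [Field K] {W : WeierstrassCurve K} :
    W.toAffine.Point → Fin 3 → K
  | .zero => ![0, 1, 0]
  | .some x y _ => ![x, y, 1]

/-- Let `A` and `B` be projective curves over `ℚ`, in weighted projective planes with weights `w` and
`v`, given by their points over all extension fields of `ℚ`, with homogeneous coordinates `cA`, `cB`.
A family of maps `A(K) → B(K)` is a morphism of curves over `ℚ` if, locally near every point, it is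
given in homogeneous coordinates by polynomials `F 0`, `F 1`, `F 2` with rational coefficients,
weighted homogeneous of degrees `n * v 0`, `n * v 1`, `n * v 2`: at the given point they do not vanish
simultaneously, and they represent the map wherever they do not vanish simultaneously. -/
def IsRegularMap (w v : Fin 3 → ℕ) {A B : ∀ (K : Type) [Field K] [Algebra ℚ K], Type}
    (cA : ∀ (K : Type) [Field K] [Algebra ℚ K], A K → Fin 3 → K)
    (cB : ∀ (K : Type) [Field K] [Algebra ℚ K], B K → Fin 3 → K)
    (φ : ∀ (K : Type) [Field K] [Algebra ℚ K], A K → B K) : Prop :=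
  ∀ (K : Type) [Field K] [Algebra ℚ K] (P : A K),
    ∃ (n : ℕ) (F : Fin 3 → MvPolynomial (Fin 3) ℚ),
      (∀ i, (F i).IsWeightedHomogeneous w (n * v i)) ∧
      (∃ i, MvPolynomial.aeval (cA K P) (F i) ≠ 0) ∧
      ∀ (L : Type) [Field L] [Algebra ℚ L] (R : A L),
        (∃ i, MvPolynomial.aeval (cA L R) (F i) ≠ 0) →
        ∃ t : L, t ≠ 0 ∧ ∀ i, MvPolynomial.aeval (cA L R) (F i) = t ^ v i * cB L (φ L R) i

namespace QuarticCurve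

/-- An isomorphism over `ℚ` from the projective quartic curve `Q ⊆ ℙ(1, 2, 1)` onto the projective
Weierstrass curve `W ⊆ ℙ²`. -/
structure Isom (Q : QuarticCurve) (W : WeierstrassCurve ℚ) where
  toEquiv : ∀ (K : Type) [Field K] [Algebra ℚ K], Q.Point K ≃ (W⁄K).toAffine.Point
  regular : IsRegularMap ![1, 2, 1] ![1, 1, 1]
    (A := fun K _ _ => Q.Point K) (B := fun K _ _ => (W⁄K).toAffine.Point)
    (fun _ _ _ => Point.coords) (fun _ _ _ => WeierstrassCurve.projCoords)
    (fun K _ _ => toEquiv K)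
  regular_symm : IsRegularMap ![1, 1, 1] ![1, 2, 1]
    (A := fun K _ _ => (W⁄K).toAffine.Point) (B := fun K _ _ => Q.Point K)
    (fun _ _ _ => WeierstrassCurve.projCoords) (fun _ _ _ => Point.coords)
    (fun K _ _ => (toEquiv K).symm)

/-- The pair `(Q, O)` is an elliptic curve over `ℚ`: an isomorphism over `ℚ` onto a Weierstrass curve
with nonzero discriminant that sends the rational point `O` to the point at infinity. -/
structure EllipticStructure (Q : QuarticCurve) (O : Q.Point ℚ) where
  W : WeierstrassCurve ℚ
  isElliptic : W.IsElliptic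
  iso : Q.Isom W
  map_origin : iso.toEquiv ℚ O = 0

namespace EllipticStructure

variable {Q : QuarticCurve} {O : Q.Point ℚ}

/-- The set `Q(ℚ)` of rational points, as the Mordell-Weil group of the elliptic curve `(Q, O)`. -/
def MordellWeil (_S : Q.EllipticStructure O) : Type := Q.Point ℚ

noncomputable instance (S : Q.EllipticStructure O) : AddCommGroup S.MordellWeil :=
  (S.iso.toEquiv ℚ).addCommGroup

/-- The Mordell-Weil rank over `ℚ`, as a cardinal number. -/
noncomputable def rank (S : Q.EllipticStructure O) : Cardinal :=
  Module.rank ℤ S.MordellWeil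

end EllipticStructure

end QuarticCurve

/-- The curve `y² = α² x⁴ - (1 + α²)² x² + 4 α²`. -/
def quarticC (α : ℚ) : QuarticCurve where
  a := α ^ 2
  b := 0
  c := -(1 + α ^ 2) ^ 2
  d := 0
  e := 4 * α ^ 2

/-- The rational point `(0, 2 α)` of the curve `y² = α² x⁴ - (1 + α²)² x² + 4 α²`. -/
def basePointC (α : ℚ) : (quarticC α).Point ℚ :=
  .affine 0 (2 * α) (by simp [quarticC]; ring)

/-- The curve `y² = x³ - 27 (48 α⁴ + (1 + α²)⁴) x - 54 (1 + α²)² ((1 + α²)⁴ - 144 α⁴)`. -/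
def weierstrassC (α : ℚ) : WeierstrassCurve ℚ where
  a₁ := 0
  a₂ := 0
  a₃ := 0
  a₄ := -27 * (48 * α ^ 4 + (1 + α ^ 2) ^ 4)
  a₆ := -54 * (1 + α ^ 2) ^ 2 * ((1 + α ^ 2) ^ 4 - 144 * α ^ 4)

/-- The `x`-coordinate of the given rational point of `weierstrassC α`. -/
def pointX (α : ℚ) : ℚ :=
  3 / (4 * α ^ 4) * (1 + α ^ 2) ^ 2 *
    (3 + 12 * α ^ 2 - 22 * α ^ 4 + 12 * α ^ 6 + 3 * α ^ 8)

/-- The `y`-coordinate of the given rational point of `weierstrassC α`. -/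
def pointY (α : ℚ) : ℚ :=
  27 / (8 * α ^ 6) * (-1 + α ^ 2) ^ 2 *
    (1 + 11 * α ^ 2 + 37 * α ^ 4 + 47 * α ^ 6 + 47 * α ^ 8 + 37 * α ^ 10 + 11 * α ^ 12 + α ^ 14)

/-!
The quartic `y² = α² x⁴ - s x² + 4 α²`, `s = (1 + α²)²`, has the rational point `(0, 2 α)`, and the
classical substitution `X' = 4 α (y + 2 α) / x²`, `Y' = 4 α (X' - s) / x` turns it into
`Y'² = (X' - s) (X'² - 16 α⁴)`, which becomes `weierstrassC α` under `X = 9 X' - 3 s`, `Y = 27 Y'`.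
The discriminant is nonzero because `s - 4 α² = (1 - α²)²` and `s + 4 α²` do not vanish. The map and
its inverse are each given by two systems of homogeneous polynomials without common zeros
(`quarticIsomWeierstrass`).

The infinite order of the given point is a `p`-adic statement. Since `α ≠ 0, 1, -1`, some prime `p`
divides `α` or `α⁻¹`, and the curve and the point at `α⁻¹` are scaled copies of those at `α`. The
point is then so close to infinity in the `p`-adic topology that `a₄ / X²` and `a₆ / X³` are
divisible by `p²` (`exists_div_pointX_pow_eq`). A point with this property has infinite order
(`WeierstrassCurve.Affine.addOrderOf_eq_zero_of_div_mem`): the parameter `z = -x / y` is additive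
near infinity up to an error that is small relative to `z` (`InFormalBall.add`). Hence
multiplication by an integer prime to `p` preserves `|z|`, multiplication by `p` divides it by `p`,
and no positive multiple of the point reaches `z = 0`. Both steps work for every `p`, including
`2` and `3`.
-/

/-! ### Points close to infinity on a short Weierstrass curve -/

section FormalGroup

namespace WeierstrassCurve.Affine

variable {F : Type*} [Field F] {W : WeierstrassCurve.Affine F} [W.IsShortNF]

lemma equation_iff_of_isShortNF {x y : F} : W.Equation x y ↔ y ^ 2 = x ^ 3 + W.a₄ * x + W.a₆ := by
  rw [equation_iff]
  simp [a₂_of_isShortNF]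

lemma negY_of_isShortNF (x y : F) : W.negY x y = -y := by
  simp [negY]

/-- In the coordinates `z = -x / y`, `w = -1 / y` at infinity the curve is
`w = z³ + a₄ z w² + a₆ w³`, and the chord (or tangent) through two points has slope
`l = (z₁² + z₁ z₂ + z₂² + a₄ w₂²) / (1 - a₄ z₁ (w₁ + w₂) - a₆ (w₁² + w₁ w₂ + w₂²))`, a formula that
covers both cases. Here denominators are cleared; the conclusion says that this line
`w = l z + m` is the line `y = (l / m) x - 1 / m` through the two points, where
`m y₁ = l x₁ - 1`. -/
lemma slope_mul_sub_one_eq [CharZero F] [DecidableEq F] {x₁ x₂ y₁ y₂ l : F} (h₁ : W.Equation x₁ y₁)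
    (h₂ : W.Equation x₂ y₂) (hxy : ¬(x₁ = x₂ ∧ y₁ = W.negY x₂ y₂)) (hy₁ : y₁ ≠ 0) (hy₂ : y₂ ≠ 0)
    (hl : l * (y₁ ^ 2 * y₂ ^ 2 - W.a₄ * x₁ * y₂ * (y₁ + y₂) -
      W.a₆ * (y₁ ^ 2 + y₁ * y₂ + y₂ ^ 2)) =
        x₁ ^ 2 * y₂ ^ 2 + x₁ * x₂ * y₁ * y₂ + x₂ ^ 2 * y₁ ^ 2 + W.a₄ * y₁ ^ 2)
    (hD : y₁ ^ 2 * y₂ ^ 2 - W.a₄ * x₁ * y₂ * (y₁ + y₂) -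
      W.a₆ * (y₁ ^ 2 + y₁ * y₂ + y₂ ^ 2) ≠ 0) :
    l * x₁ - 1 ≠ 0 ∧ W.slope x₁ x₂ y₁ y₂ * (l * x₁ - 1) = l * y₁ := by
  rw [equation_iff_of_isShortNF] at h₁ h₂
  rw [negY_of_isShortNF] at hxy
  by_cases hx : x₁ = x₂
  · subst hx
    have hyy : y₁ = y₂ := by
      refine (sq_eq_sq_iff_eq_or_eq_neg.mp (h₁.trans h₂.symm)).resolve_right fun h => hxy ⟨rfl, h⟩
    subst hyy
    have hyn : y₁ ≠ W.negY x₁ y₁ := by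
      rw [negY_of_isShortNF]
      exact fun h => hxy ⟨rfl, h⟩
    rw [slope_of_Y_ne rfl hyn, negY_of_isShortNF]
    simp only [a₁_of_isShortNF, a₂_of_isShortNF]
    have key : (l * x₁ - 1) * (y₁ ^ 2 * y₁ ^ 2 - W.a₄ * x₁ * y₁ * (y₁ + y₁) -
      W.a₆ * (y₁ ^ 2 + y₁ * y₁ + y₁ ^ 2)) = 2 * y₁ ^ 4 := by
      linear_combination x₁ * hl - 3 * y₁ ^ 2 * h₁
    refine ⟨fun h0 => ?_, ?_⟩
    · rw [h0, zero_mul] at key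
      exact mul_ne_zero two_ne_zero (pow_ne_zero 4 hy₁) key.symm
    · apply mul_right_cancel₀ hD
      have : y₁ - -y₁ = 2 * y₁ := by ring
      rw [this, mul_assoc, key]
      field_simp
      apply mul_left_cancel₀ (pow_ne_zero 2 hy₁)
      linear_combination -hl
  · rw [slope_of_X_ne hx]
    have hd : x₁ - x₂ ≠ 0 := sub_ne_zero.mpr hx
    have key : (l * x₁ - 1) * y₂ = (l * x₂ - 1) * y₁ := by
      apply mul_right_cancel₀ hD
      linear_combination (x₁ * y₂ - x₂ * y₁) * hl - y₂ ^ 3 * h₁ + y₁ ^ 3 * h₂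
    have hne : l * x₁ - 1 ≠ 0 := by
      intro h0
      have h3 : l * x₂ - 1 = 0 := by
        rw [h0, zero_mul, zero_eq_mul] at key
        exact key.resolve_right hy₁
      have : l * (x₁ - x₂) = 0 := by linear_combination h0 - h3
      rcases mul_eq_zero.mp this with rfl | h
      · simp at h0
      · exact hd h
    refine ⟨hne, ?_⟩
    field_simp
    linear_combination -key

/-- Vieta's formulas for the three intersections of the curve with a line, written for the
functions `l x - 1`, which are proportional to `y` on the line. The first formula is the value at
`x = 1 / l` of the cubic whose roots are the three abscissae, scaled so as to allow `l = 0`; the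
second has the shape of its derivative with respect to `l`, and gives the sum of the three
parameters `-x / y`. -/
lemma sum_and_prod_addX_slope [DecidableEq F] {x₁ x₂ y₁ y₂ l : F} (h₁ : W.Equation x₁ y₁)
    (h₂ : W.Equation x₂ y₂) (hxy : ¬(x₁ = x₂ ∧ y₁ = W.negY x₂ y₂))
    (hl : l * x₁ - 1 ≠ 0) (hs : W.slope x₁ x₂ y₁ y₂ * (l * x₁ - 1) = l * y₁) :
    (l * x₁ - 1) * (l * x₂ - 1) * (l * W.addX x₁ x₂ (W.slope x₁ x₂ y₁ y₂) - 1) =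
      -(1 + W.a₄ * l ^ 2 + W.a₆ * l ^ 3) ∧
    x₁ * (l * x₂ - 1) * (l * W.addX x₁ x₂ (W.slope x₁ x₂ y₁ y₂) - 1) +
      x₂ * (l * x₁ - 1) * (l * W.addX x₁ x₂ (W.slope x₁ x₂ y₁ y₂) - 1) +
      W.addX x₁ x₂ (W.slope x₁ x₂ y₁ y₂) * (l * x₁ - 1) * (l * x₂ - 1) =
      -(2 * W.a₄ * l + 3 * W.a₆ * l ^ 2) := by
  have hpoly := addPolynomial_slope h₁ h₂ hxy
  have e₀ : W.addX x₁ x₂ (W.slope x₁ x₂ y₁ y₂) = (W.slope x₁ x₂ y₁ y₂) ^ 2 - x₁ - x₂ := by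
    simp [addX, a₂_of_isShortNF]
  generalize W.slope x₁ x₂ y₁ y₂ = ℓ at *
  generalize W.addX x₁ x₂ ℓ = x₃ at *
  rw [addPolynomial_eq, Cubic.toPoly] at hpoly
  have p₀ := congrArg (Polynomial.eval 0) hpoly
  have p₁ := congrArg (Polynomial.eval 1) hpoly
  simp [a₂_of_isShortNF] at p₀ p₁
  have e₃ : x₁ * x₂ * x₃ = x₁ ^ 2 * ℓ ^ 2 - 2 * x₁ * y₁ * ℓ + y₁ ^ 2 - W.a₆ := by
    linear_combination -p₀
  have e₂ : x₁ * x₂ + x₁ * x₃ + x₂ * x₃ = 2 * x₁ * ℓ ^ 2 - 2 * y₁ * ℓ + W.a₄ := by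
    linear_combination p₁ - p₀ + e₀
  obtain ⟨k, rfl⟩ : ∃ k, y₁ = k * (l * x₁ - 1) := ⟨y₁ / (l * x₁ - 1), by field_simp⟩
  obtain rfl : ℓ = l * k := mul_right_cancel₀ hl (by linear_combination hs)
  constructor
  · linear_combination l ^ 3 * e₃ - l ^ 2 * e₂ + l * e₀
  · linear_combination 3 * l ^ 2 * e₃ - 2 * l * e₂ + e₀

/-- The point `P` has coordinates `-x / y = π u` and `-1 / y = π³ s` at infinity with `u, s ∈ R`.
For `R` the ring of integers of a valuation this says that `P` lies in the ball of radius `|π|`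
of the formal group, with rescaled parameter `u`; the point at infinity has parameter `0`. -/
def InFormalBall (W : WeierstrassCurve.Affine F) (R : Subring F) (π : F) (u : F) : W.Point → Prop
  | .zero => u = 0
  | .some x y _ => u ∈ R ∧ x = -(π * u * y) ∧ ∃ s ∈ R, π ^ 3 * s * y = -1

/-- The equation of the curve in the coordinates `z = -x / y = π u`, `w = -1 / y = π ^ 3 s` at
infinity. -/
lemma formal_equation {q π u s a b x y : F} (ha4 : W.a₄ * π ^ 4 = q * a)
    (hb6 : W.a₆ * π ^ 6 = q * b) (h : W.Equation x y) (hx : x = -(π * u * y))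
    (hs : π ^ 3 * s * y = -1) : s = u ^ 3 + q * a * u * s ^ 2 + q * b * s ^ 3 := by
  have hπ : π ≠ 0 := by rintro rfl; simp at hs
  have hy0 : y ≠ 0 := by rintro rfl; simp at hs
  have hs' : s = -1 / (π ^ 3 * y) := by
    field_simp
    linear_combination hs
  rw [equation_iff_of_isShortNF, hx] at h
  rw [← ha4, ← hb6, hs']
  field_simp
  linear_combination -h

/-- Addition of points near infinity is addition of the parameters, up to an error divisible by
the modulus `q` that divides the coefficients of the rescaled curve. -/
lemma InFormalBall.add [CharZero F] [DecidableEq F] {R : Subring F} {q π u v a b : F} {P Q : W.Point}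
    (hq : q ∈ R) (hR : ∀ r ∈ R, 1 + q * r ≠ 0 ∧ (1 + q * r)⁻¹ ∈ R)
    (ha : a ∈ R) (hb : b ∈ R) (ha4 : W.a₄ * π ^ 4 = q * a) (hb6 : W.a₆ * π ^ 6 = q * b)
    (hP : InFormalBall W R π u P) (hQ : InFormalBall W R π v Q) :
    ∃ r ∈ R, InFormalBall W R π (u + v + q * r) (P + Q) := by
  rcases P with _ | ⟨x₁, y₁, h₁⟩
  · refine ⟨0, R.zero_mem, ?_⟩
    obtain rfl : u = 0 := hP
    change InFormalBall W R π _ (0 + Q)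
    simpa using hQ
  rcases Q with _ | ⟨x₂, y₂, h₂⟩
  · refine ⟨0, R.zero_mem, ?_⟩
    obtain rfl : v = 0 := hQ
    change InFormalBall W R π _ (_ + 0)
    simpa using hP
  obtain ⟨hu, hx₁, s, hs, hy₁⟩ := hP
  obtain ⟨hv, hx₂, t, ht, hy₂⟩ := hQ
  have hπ : π ≠ 0 := by rintro rfl; simp at hy₁
  have hy₁0 : y₁ ≠ 0 := by rintro rfl; simp at hy₁
  have hy₂0 : y₂ ≠ 0 := by rintro rfl; simp at hy₂
  by_cases hxy : x₁ = x₂ ∧ y₁ = W.negY x₂ y₂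
  · refine ⟨0, R.zero_mem, ?_⟩
    rw [Point.add_of_Y_eq hxy.1 hxy.2]
    change u + v + q * 0 = 0
    rw [negY_of_isShortNF] at hxy
    apply mul_left_cancel₀ (mul_ne_zero hπ hy₂0)
    rw [hx₁, hx₂, hxy.2] at hxy
    linear_combination hxy.1
  -- `π² l` is the slope of the line in the coordinates at infinity, `D` its denominator.
  obtain ⟨hD0, hDR⟩ := hR (-(a * u * (s + t) + b * (s ^ 2 + s * t + t ^ 2))) (by
    exact R.neg_mem (R.add_mem (R.mul_mem (R.mul_mem ha hu) (R.add_mem hs ht)) (R.mul_mem hb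
      (R.add_mem (R.add_mem (R.pow_mem hs 2) (R.mul_mem hs ht)) (R.pow_mem ht 2)))))
  set D := 1 + q * -(a * u * (s + t) + b * (s ^ 2 + s * t + t ^ 2)) with hD
  set l := (u ^ 2 + u * v + v ^ 2 + q * a * t ^ 2) * D⁻¹ with hl
  have hlR : l ∈ R := R.mul_mem (R.add_mem (R.add_mem (R.add_mem (R.pow_mem hu 2) (R.mul_mem hu hv))
    (R.pow_mem hv 2)) (R.mul_mem (R.mul_mem hq ha) (R.pow_mem ht 2))) hDR
  have hlD : l * D = u ^ 2 + u * v + v ^ 2 + q * a * t ^ 2 := by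
    rw [hl, mul_assoc, inv_mul_cancel₀ hD0, mul_one]
  clear_value l
  obtain ⟨hE0, hER⟩ := hR (a * l ^ 2 + b * l ^ 3)
    (R.add_mem (R.mul_mem ha (R.pow_mem hlR 2)) (R.mul_mem hb (R.pow_mem hlR 3)))
  have hs' : s = -1 / (π ^ 3 * y₁) := by
    field_simp
    linear_combination hy₁
  have ht' : t = -1 / (π ^ 3 * y₂) := by
    field_simp
    linear_combination hy₂
  have hDy : y₁ ^ 2 * y₂ ^ 2 - W.a₄ * x₁ * y₂ * (y₁ + y₂) -
      W.a₆ * (y₁ ^ 2 + y₁ * y₂ + y₂ ^ 2) = D * (y₁ ^ 2 * y₂ ^ 2) := by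
    have : D = 1 - (W.a₄ * π ^ 4 * u * (s + t) + W.a₆ * π ^ 6 * (s ^ 2 + s * t + t ^ 2)) := by
      rw [ha4, hb6, hD]
      ring
    rw [this, hs', ht', hx₁]
    field_simp
    ring
  have hlx : l * π ^ 2 * (y₁ ^ 2 * y₂ ^ 2 - W.a₄ * x₁ * y₂ * (y₁ + y₂) -
      W.a₆ * (y₁ ^ 2 + y₁ * y₂ + y₂ ^ 2)) =
        x₁ ^ 2 * y₂ ^ 2 + x₁ * x₂ * y₁ * y₂ + x₂ ^ 2 * y₁ ^ 2 + W.a₄ * y₁ ^ 2 := by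
    have : l * π ^ 2 * (D * (y₁ ^ 2 * y₂ ^ 2)) = (l * D) * (π ^ 2 * (y₁ ^ 2 * y₂ ^ 2)) := by ring
    rw [hDy, this, hlD, ← ha4, ht', hx₁, hx₂]
    field_simp
  obtain ⟨hne, hsl⟩ := slope_mul_sub_one_eq h₁.1 h₂.1 hxy hy₁0 hy₂0 hlx
    (hDy ▸ mul_ne_zero hD0 (by positivity))
  obtain ⟨hprod, hsum⟩ := sum_and_prod_addX_slope h₁.1 h₂.1 hxy hne hsl
  have hcP := formal_equation ha4 hb6 h₁.1 hx₁ hy₁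
  have hcQ := formal_equation ha4 hb6 h₂.1 hx₂ hy₂
  have hst : s - t = l * (u - v) := by
    apply mul_right_cancel₀ hD0
    linear_combination (u - v) * (-hlD) + hcP - hcQ
  have hl₁ : l * π ^ 2 * x₁ - 1 = (s - l * u) * π ^ 3 * y₁ := by
    linear_combination l * π ^ 2 * hx₁ - hy₁
  have hl₂ : l * π ^ 2 * x₂ - 1 = (s - l * u) * π ^ 3 * y₂ := by
    linear_combination l * π ^ 2 * hx₂ - hy₂ - π ^ 3 * y₂ * hst
  have hmR : s - l * u ∈ R := R.sub_mem hs (R.mul_mem hlR hu)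
  have hm0 : s - l * u ≠ 0 := by
    intro h0
    simp [hl₁, h0] at hne
  rw [Point.add_some hxy]
  -- The line is `w = π² l z + π³ m`, and the cubic in `z` that it cuts out has leading
  -- coefficient `1 + q (a l² + b l³)`.
  generalize hm : s - l * u = m at *
  have hE : 1 + W.a₄ * (l * π ^ 2) ^ 2 + W.a₆ * (l * π ^ 2) ^ 3 = 1 + q * (a * l ^ 2 + b * l ^ 3) := by
    linear_combination l ^ 2 * ha4 + l ^ 3 * hb6
  rw [hE] at hprod
  have hslope : W.slope x₁ x₂ y₁ y₂ * (m * π ^ 3) = l * π ^ 2 := by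
    apply mul_right_cancel₀ hy₁0
    linear_combination hsl - W.slope x₁ x₂ y₁ y₂ * hl₁
  have hy₃ : (W.slope x₁ x₂ y₁ y₂ * (W.addX x₁ x₂ (W.slope x₁ x₂ y₁ y₂) - x₁) + y₁) * (m * π ^ 3) =
      l * π ^ 2 * W.addX x₁ x₂ (W.slope x₁ x₂ y₁ y₂) - 1 := by
    linear_combination (W.addX x₁ x₂ (W.slope x₁ x₂ y₁ y₂) - x₁) * hslope - hl₁
  have hyadd : W.addY x₁ x₂ y₁ (W.slope x₁ x₂ y₁ y₂) =
      -(W.slope x₁ x₂ y₁ y₂ * (W.addX x₁ x₂ (W.slope x₁ x₂ y₁ y₂) - x₁) + y₁) := by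
    rw [addY, negY_of_isShortNF, negAddY]
  set r := m * (2 * a * l + 3 * b * l ^ 2) * (1 + q * (a * l ^ 2 + b * l ^ 3))⁻¹ with hr
  have hrR : r ∈ R := by
    refine R.mul_mem (R.mul_mem hmR (R.add_mem (R.mul_mem (R.mul_mem ?_ ha) hlR)
      (R.mul_mem (R.mul_mem ?_ hb) (R.pow_mem hlR 2)))) hER
    · exact ofNat_mem R 2
    · exact ofNat_mem R 3
  have hrE : r * (1 + q * (a * l ^ 2 + b * l ^ 3)) = m * (2 * a * l + 3 * b * l ^ 2) := by
    rw [hr, mul_assoc, inv_mul_cancel₀ hE0, mul_one]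
  clear_value r
  have hx₃ : W.addX x₁ x₂ (W.slope x₁ x₂ y₁ y₂) = -(π * (u + v + q * r) *
      W.addY x₁ x₂ y₁ (W.slope x₁ x₂ y₁ y₂)) := by
    rw [hyadd]
    apply mul_right_cancel₀ (mul_ne_zero (mul_ne_zero (pow_ne_zero 3 hm0) (pow_ne_zero 8 hπ))
      (mul_ne_zero hy₁0 hy₂0))
    rw [hl₁, hl₂] at hprod hsum
    generalize W.addX x₁ x₂ (W.slope x₁ x₂ y₁ y₂) = x₃ at *
    generalize W.slope x₁ x₂ y₁ y₂ = k at *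
    linear_combination -π * (u + v + q * r) * m ^ 2 * π ^ 5 * y₁ * y₂ * hy₃ + m * π ^ 2 * hsum -
      m ^ 2 * π ^ 5 * (l * π ^ 2 * x₃ - 1) * (y₂ * hx₁ + y₁ * hx₂) - q * r * hprod -
      m * (2 * l * ha4 + 3 * l ^ 2 * hb6) + q * hrE
  have hsR : l * (u + v + q * r) - m ∈ R :=
    R.sub_mem (R.mul_mem hlR (R.add_mem (R.add_mem hu hv) (R.mul_mem hq hrR))) hmR
  refine ⟨r, hrR, R.add_mem (R.add_mem hu hv) (R.mul_mem hq hrR), hx₃, _, hsR, ?_⟩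
  rw [hyadd] at hx₃ ⊢
  linear_combination hy₃ + l * π ^ 2 * hx₃

lemma InFormalBall.nsmul [CharZero F] [DecidableEq F] {R : Subring F} {q π u a b : F} {P : W.Point}
    (hq : q ∈ R) (hR : ∀ r ∈ R, 1 + q * r ≠ 0 ∧ (1 + q * r)⁻¹ ∈ R)
    (ha : a ∈ R) (hb : b ∈ R) (ha4 : W.a₄ * π ^ 4 = q * a) (hb6 : W.a₆ * π ^ 6 = q * b)
    (hP : InFormalBall W R π u P) (n : ℕ) :
    ∃ r ∈ R, InFormalBall W R π (n * u + q * r) (n • P) := by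
  induction n with
  | zero => exact ⟨0, R.zero_mem, by rw [zero_smul]; show _ = _; simp⟩
  | succ n ih =>
    obtain ⟨r, hr, h⟩ := ih
    obtain ⟨r', hr', h'⟩ := h.add hq hR ha hb ha4 hb6 hP
    refine ⟨r + r', R.add_mem hr hr', ?_⟩
    rw [succ_nsmul]
    convert h' using 1
    push_cast
    ring

/-- A point whose parameter is divisible by `p` lies in the smaller ball of radius `|π p|`: the
equation of the curve writes `s` as `(p u)³` times a unit. -/
lemma InFormalBall.rescale {R : Subring F} {p q π u a b : F} {P : W.Point} (hp : p ≠ 0)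
    (hp' : p ∈ R) (hR : ∀ r ∈ R, 1 + q * r ≠ 0 ∧ (1 + q * r)⁻¹ ∈ R)
    (ha : a ∈ R) (hb : b ∈ R) (ha4 : W.a₄ * π ^ 4 = q * a) (hb6 : W.a₆ * π ^ 6 = q * b)
    (hu : u ∈ R) (hP : InFormalBall W R π (p * u) P) : InFormalBall W R (π * p) u P := by
  rcases P with _ | ⟨x, y, h⟩
  · exact (mul_eq_zero.mp hP).resolve_left hp
  · obtain ⟨-, hx, s, hs, hy⟩ := hP
    have hc := formal_equation ha4 hb6 h.1 hx hy
    obtain ⟨h0, h1⟩ := hR (-(a * (p * u) * s + b * s ^ 2)) (R.neg_mem (R.add_mem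
      (R.mul_mem (R.mul_mem ha (R.mul_mem hp' hu)) hs) (R.mul_mem hb (R.pow_mem hs 2))))
    set D := 1 + q * -(a * (p * u) * s + b * s ^ 2) with hD
    have hs' : s = p ^ 3 * (u ^ 3 * D⁻¹) := by
      field_simp
      linear_combination hc
    refine ⟨hu, by rw [hx]; ring, u ^ 3 * D⁻¹, R.mul_mem (R.pow_mem hu 3) h1, ?_⟩
    rw [← hy, hs']
    ring

/-- A point whose parameter is a unit has no nonzero multiple equal to the point at infinity. If
`p ∤ n`, then `n • P` has parameter `n u ≠ 0` modulo `p²`; if `p ∣ n`, then `p • P` has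
parameter `p u` modulo `p²`, hence unit parameter in the ball of radius `|π p|`, and `n / p`
takes the place of `n`. -/
lemma InFormalBall.nsmul_ne_zero [CharZero F] [DecidableEq F] {R : Subring F} {p : ℕ}
    (hp : 1 < p) (hR : ∀ r ∈ R, 1 + p * r ≠ 0 ∧ (1 + p * r)⁻¹ ∈ R)
    (hn : ∀ n : ℕ, ¬ p ∣ n → (n : F)⁻¹ ∈ R) (n : ℕ) (hn0 : n ≠ 0) {π u a b : F} {P : W.Point}
    (ha : a ∈ R) (hb : b ∈ R) (ha4 : W.a₄ * π ^ 4 = p ^ 2 * a) (hb6 : W.a₆ * π ^ 6 = p ^ 2 * b)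
    (hu : u ∈ R) (hu0 : u ≠ 0) (hu' : u⁻¹ ∈ R) (hP : InFormalBall W R π u P) : n • P ≠ 0 := by
  have hpR : (p : F) ∈ R := natCast_mem R p
  have hR' (r : F) (hr : r ∈ R) : 1 + (p : F) ^ 2 * r ≠ 0 ∧ (1 + (p : F) ^ 2 * r)⁻¹ ∈ R := by
    simpa only [sq, mul_assoc] using hR (p * r) (R.mul_mem hpR hr)
  induction n using Nat.strong_induction_on generalizing π u a b P with
  | _ n ih =>
    by_cases hpn : p ∣ n
    · obtain ⟨k, rfl⟩ := hpn
      obtain ⟨r, hr, h⟩ := hP.nsmul (R.pow_mem hpR 2) hR' ha hb ha4 hb6 p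
      have hru : u⁻¹ * r ∈ R := R.mul_mem hu' hr
      obtain ⟨h0, h1⟩ := hR _ hru
      have e : u + p * r = u * (1 + p * (u⁻¹ * r)) := by field_simp
      have hu₂ : u + p * r ∈ R := R.add_mem hu (R.mul_mem hpR hr)
      have h' : InFormalBall W R (π * p) (u + p * r) (p • P) := by
        refine InFormalBall.rescale (Nat.cast_ne_zero.mpr (by lia)) hpR hR' ha hb ha4 hb6 hu₂ ?_
        convert h using 1
        ring
      rw [mul_comm, mul_smul]
      have hk : k ≠ 0 := right_ne_zero_of_mul hn0
      refine ih k (lt_mul_left (Nat.pos_of_ne_zero hk) hp) hk (R.mul_mem (R.pow_mem hpR 4) ha)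
        (R.mul_mem (R.pow_mem hpR 6) hb) ?_ ?_ hu₂ ?_ ?_ h'
      · linear_combination (p : F) ^ 4 * ha4
      · linear_combination (p : F) ^ 6 * hb6
      · exact e ▸ mul_ne_zero hu0 h0
      · rw [e, mul_inv]
        exact R.mul_mem hu' h1
    · obtain ⟨r, hr, h⟩ := hP.nsmul (R.pow_mem hpR 2) hR' ha hb ha4 hb6 n
      intro h0
      rw [h0] at h
      have h : n * u + (p : F) ^ 2 * r = 0 := h
      have hn' : (n : F) ≠ 0 := Nat.cast_ne_zero.mpr hn0
      apply (hR' (r * (u⁻¹ * (n : F)⁻¹)) (R.mul_mem hr (R.mul_mem hu' (hn n hpn)))).1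
      field_simp
      linear_combination h

/-- If `a₄ / x²` and `a₆ / x³` are divisible by `p²`, then `(x, y)` has infinite order. The
hypotheses are invariant under scaling of the curve, so no integral model is needed. -/
theorem addOrderOf_eq_zero_of_div_mem [CharZero F] [DecidableEq F] {R : Subring F} {p : ℕ}
    (hp : 1 < p) (hR : ∀ r ∈ R, 1 + p * r ≠ 0 ∧ (1 + p * r)⁻¹ ∈ R)
    (hn : ∀ n : ℕ, ¬ p ∣ n → (n : F)⁻¹ ∈ R) {x y a b : F} (h : W.Nonsingular x y) (hx : x ≠ 0)
    (ha : a ∈ R) (hb : b ∈ R) (ha4 : W.a₄ / x ^ 2 = p ^ 2 * a) (hb6 : W.a₆ / x ^ 3 = p ^ 2 * b) :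
    addOrderOf (Point.some x y h) = 0 := by
  have hpR : (p : F) ∈ R := natCast_mem R p
  have hab := R.mul_mem hpR (R.add_mem ha hb)
  obtain ⟨h0, h1⟩ := hR _ hab
  have hE := equation_iff_of_isShortNF.mp h.1
  set s := 1 + p * (p * (a + b)) with hs
  have hsR : s ∈ R := R.add_mem R.one_mem (R.mul_mem hpR hab)
  rw [div_eq_iff (by positivity)] at ha4 hb6
  have hy2 : y ^ 2 = x ^ 3 * s := by
    rw [hE, ha4, hb6, hs]
    ring
  have hy : y ≠ 0 := by
    rintro rfl
    rw [zero_pow two_ne_zero] at hy2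
    exact mul_ne_zero (pow_ne_zero 3 hx) h0 hy2.symm
  have hxy : x ^ 3 / y ^ 2 = s⁻¹ := by
    rw [hy2]
    field_simp
  rw [addOrderOf_eq_zero_iff']
  intro n hn0
  -- With `π = -x / y` the point has parameter `1`.
  refine InFormalBall.nsmul_ne_zero (R := R) (π := -x / y) (u := 1) hp hR hn n hn0.ne'
    (R.mul_mem ha (R.pow_mem h1 2)) (R.mul_mem hb (R.pow_mem h1 3)) ?_ ?_ R.one_mem one_ne_zero
    (by simp [R.one_mem]) ⟨R.one_mem, by field_simp, s, hsR, ?_⟩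
  · rw [← hxy, ha4]
    field_simp
  · rw [← hxy, hb6]
    field_simp
  · field_simp
    linear_combination hy2

end WeierstrassCurve.Affine

end FormalGroup

/-! ### The ring of `p`-integral rational numbers -/

section PadicIntegers

variable {p : ℕ} [Fact p.Prime]

lemma inv_natCast_mem_padicValuation_integer {n : ℕ} (h : ¬ p ∣ n) :
    (n : ℚ)⁻¹ ∈ (Rat.padicValuation p).integer := by
  have h1 : Rat.padicValuation p (n : ℤ) = 1 := by
    rw [Rat.padicValuation_cast, Int.padicValuation_eq_one_iff, Int.natCast_dvd_natCast]
    exact h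
  rw [Valuation.mem_integer_iff, map_inv₀, ← Int.cast_natCast, h1, inv_one]

lemma inv_one_add_mem_padicValuation_integer {r : ℚ} (h : r ∈ (Rat.padicValuation p).integer) :
    1 + p * r ≠ 0 ∧ (1 + p * r)⁻¹ ∈ (Rat.padicValuation p).integer := by
  have hlt : Rat.padicValuation p (p * r) < 1 := by
    rw [map_mul]
    refine mul_lt_one_of_lt_of_le ?_ h
    rw [Rat.padicValuation_self, ← WithZero.exp_zero, WithZero.exp_lt_exp]
    exact neg_one_lt_zero
  have h1 := Valuation.map_one_add_of_lt _ hlt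
  constructor
  · rw [← (Rat.padicValuation p).ne_zero_iff, h1]
    exact one_ne_zero
  · rw [Valuation.mem_integer_iff, map_inv₀, h1, inv_one]

end PadicIntegers

/-! ### The bijection between the quartic and the Weierstrass curve -/

section Isomorphism

lemma weierstrassC_isElliptic {α : ℚ} (h0 : α ≠ 0) (h1 : α ≠ 1) (hneg1 : α ≠ -1) :
    (weierstrassC α).IsElliptic := by
  have hs : (1 + α ^ 2) ^ 2 + 4 * α ^ 2 ≠ 0 := by positivity
  have hd : (α - 1) * (α + 1) ≠ 0 :=
    mul_ne_zero (sub_ne_zero.mpr h1) (fun h => hneg1 (by linarith))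
  have hΔ : (weierstrassC α).Δ = 16 * (72 * α ^ 2 * (9 * ((α - 1) * (α + 1)) ^ 2) *
      (9 * ((1 + α ^ 2) ^ 2 + 4 * α ^ 2))) ^ 2 := by
    simp only [weierstrassC, WeierstrassCurve.Δ, WeierstrassCurve.b₂, WeierstrassCurve.b₄,
      WeierstrassCurve.b₆, WeierstrassCurve.b₈]
    ring
  rw [WeierstrassCurve.isElliptic_iff, hΔ, isUnit_iff_ne_zero]
  positivity

variable {α : ℚ} {K : Type} [Field K] [Algebra ℚ K]

lemma quarticC_equation_iff {x y : K} :
    y ^ 2 = algebraMap ℚ K (quarticC α).a * x ^ 4 + algebraMap ℚ K (quarticC α).b * x ^ 3 +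
      algebraMap ℚ K (quarticC α).c * x ^ 2 + algebraMap ℚ K (quarticC α).d * x +
      algebraMap ℚ K (quarticC α).e ↔
    y ^ 2 = algebraMap ℚ K α ^ 2 * x ^ 4 - (1 + algebraMap ℚ K α ^ 2) ^ 2 * x ^ 2 +
      4 * algebraMap ℚ K α ^ 2 := by
  simp only [quarticC, map_zero, map_mul, map_neg, map_add, map_pow, map_one, map_ofNat]
  ring_nf

lemma quarticC_infinity_iff {v : K} :
    v ^ 2 = algebraMap ℚ K (quarticC α).a ↔ v ^ 2 = algebraMap ℚ K α ^ 2 := by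
  simp [quarticC]

/-- The equation of `weierstrassC α` in factored form: the curve has full rational `2`-torsion. -/
lemma weierstrassC_equation_iff {x y : K} :
    ((weierstrassC α)⁄K).toAffine.Equation x y ↔
    y ^ 2 = (x - 6 * (1 + algebraMap ℚ K α ^ 2) ^ 2) *
      ((x + 3 * (1 + algebraMap ℚ K α ^ 2) ^ 2) ^ 2 - (36 * algebraMap ℚ K α ^ 2) ^ 2) := by
  rw [WeierstrassCurve.Affine.equation_iff]
  simp only [weierstrassC, WeierstrassCurve.baseChange, WeierstrassCurve.map, map_zero, map_mul,
    map_neg, map_add, map_sub, map_pow, map_one, map_ofNat]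
  constructor <;> intro h <;> linear_combination h

lemma weierstrassC_nonsingular [(weierstrassC α).IsElliptic] {x y : K}
    (h : y ^ 2 = (x - 6 * (1 + algebraMap ℚ K α ^ 2) ^ 2) *
      ((x + 3 * (1 + algebraMap ℚ K α ^ 2) ^ 2) ^ 2 - (36 * algebraMap ℚ K α ^ 2) ^ 2)) :
    ((weierstrassC α)⁄K).toAffine.Nonsingular x y :=
  have : ((weierstrassC α)⁄K).toAffine.IsElliptic :=
    inferInstanceAs ((weierstrassC α).map (algebraMap ℚ K)).IsElliptic
  WeierstrassCurve.Affine.equation_iff_nonsingular.mp (weierstrassC_equation_iff.mpr h)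

lemma ne_zero_of_isElliptic (α : ℚ) [h : (weierstrassC α).IsElliptic] : α ≠ 0 := by
  rintro rfl
  rw [WeierstrassCurve.isElliptic_iff, isUnit_iff_ne_zero] at h
  apply h
  simp [weierstrassC, WeierstrassCurve.Δ, WeierstrassCurve.b₂, WeierstrassCurve.b₄,
    WeierstrassCurve.b₆, WeierstrassCurve.b₈]
  norm_num

lemma sq_sub_ne_zero_of_isElliptic (α : ℚ) [h : (weierstrassC α).IsElliptic] :
    (9 * (1 + α ^ 2) ^ 2) ^ 2 - (36 * α ^ 2) ^ 2 ≠ 0 := by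
  intro h0
  rw [WeierstrassCurve.isElliptic_iff, isUnit_iff_ne_zero] at h
  apply h
  simp only [weierstrassC, WeierstrassCurve.Δ, WeierstrassCurve.b₂, WeierstrassCurve.b₄,
    WeierstrassCurve.b₆, WeierstrassCurve.b₈]
  linear_combination 82944 * α ^ 4 * ((9 * (1 + α ^ 2) ^ 2) ^ 2 - (36 * α ^ 2) ^ 2) * h0

variable (K) in
lemma algebraMap_ne_zero_of_isElliptic (α : ℚ) [(weierstrassC α).IsElliptic] :
    algebraMap ℚ K α ≠ 0 :=
  (map_ne_zero _).mpr (ne_zero_of_isElliptic α)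

variable (K) in
lemma algebraMap_sq_sub_ne_zero_of_isElliptic (α : ℚ) [(weierstrassC α).IsElliptic] :
    (9 * (1 + algebraMap ℚ K α ^ 2) ^ 2) ^ 2 - (36 * algebraMap ℚ K α ^ 2) ^ 2 ≠ 0 := by
  have := (map_ne_zero (algebraMap ℚ K)).mpr (sq_sub_ne_zero_of_isElliptic α)
  simpa only [map_mul, map_add, map_sub, map_pow, map_one, map_ofNat] using this

open Classical in
/-- The map from the quartic `y² = α² x⁴ - s x² + 4 α²`, `s = (1 + α²)²`, to its Weierstrass
model. For `x ≠ 0` it is `X = 9 X' - 3 s`, `Y = 27 Y'` with `X' = 4 α (y + 2 α) / x²` and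
`Y' = 4 α (X' - s) / x`, where `Y'² = (X' - s) (X'² - 16 α⁴)`. It sends `(0, 2 α)` to the point at
infinity, and `(0, -2 α)` and the two points at infinity to the points of order two. -/
noncomputable def quarticToWeierstrass (α : ℚ) [(weierstrassC α).IsElliptic] (K : Type) [Field K]
    [Algebra ℚ K] : (quarticC α).Point K → ((weierstrassC α)⁄K).toAffine.Point
  | .affine x y h =>
    if hx : x = 0 then
      if y = 2 * algebraMap ℚ K α then 0
      else .some (6 * (1 + algebraMap ℚ K α ^ 2) ^ 2) 0 (weierstrassC_nonsingular (by ring))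
    else
      .some ((36 * algebraMap ℚ K α * (y + 2 * algebraMap ℚ K α) -
          3 * (1 + algebraMap ℚ K α ^ 2) ^ 2 * x ^ 2) / x ^ 2)
        (108 * algebraMap ℚ K α * (4 * algebraMap ℚ K α * (y + 2 * algebraMap ℚ K α) -
          (1 + algebraMap ℚ K α ^ 2) ^ 2 * x ^ 2) / x ^ 3)
        (weierstrassC_nonsingular (by
          have h := quarticC_equation_iff.mp h
          field_simp
          linear_combination -11664 * algebraMap ℚ K α ^ 2 * (4 * algebraMap ℚ K α *
            (y + 2 * algebraMap ℚ K α) - (1 + algebraMap ℚ K α ^ 2) ^ 2 * x ^ 2) * h))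
  | .infinity v h =>
    .some (36 * algebraMap ℚ K α * v - 3 * (1 + algebraMap ℚ K α ^ 2) ^ 2) 0
      (weierstrassC_nonsingular (by
        have h := quarticC_infinity_iff.mp h
        linear_combination (-1) * (36 * algebraMap ℚ K α * v - 9 * (1 + algebraMap ℚ K α ^ 2) ^ 2) *
          (36 * algebraMap ℚ K α) ^ 2 * h))

open Classical in
/-- The inverse of `quarticToWeierstrass`: for `Y ≠ 0` it is `x = 12 α (X - 6 s) / Y` and
`y = -2 α + x² (X + 3 s) / (36 α)`, where `s = (1 + α²)²`. -/
noncomputable def weierstrassToQuartic (α : ℚ) [(weierstrassC α).IsElliptic] (K : Type) [Field K]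
    [Algebra ℚ K] : ((weierstrassC α)⁄K).toAffine.Point → (quarticC α).Point K
  | .zero => .affine 0 (2 * algebraMap ℚ K α) (quarticC_equation_iff.mpr (by ring))
  | .some x y h =>
    if hy : y = 0 then
      if hx : x = 6 * (1 + algebraMap ℚ K α ^ 2) ^ 2 then
        .affine 0 (-(2 * algebraMap ℚ K α)) (quarticC_equation_iff.mpr (by ring))
      else
        .infinity ((x + 3 * (1 + algebraMap ℚ K α ^ 2) ^ 2) / (36 * algebraMap ℚ K α))
          (quarticC_infinity_iff.mpr (by
            have hα := algebraMap_ne_zero_of_isElliptic K α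
            have := algebraRat.charZero K
            have h := weierstrassC_equation_iff.mp h.1
            rw [hy, zero_pow two_ne_zero, zero_eq_mul, or_iff_right (sub_ne_zero.mpr hx)] at h
            field_simp
            linear_combination h))
    else
      .affine (12 * algebraMap ℚ K α * (x - 6 * (1 + algebraMap ℚ K α ^ 2) ^ 2) / y)
        (-(2 * algebraMap ℚ K α) + 4 * algebraMap ℚ K α *
          (x - 6 * (1 + algebraMap ℚ K α ^ 2) ^ 2) ^ 2 *
          (x + 3 * (1 + algebraMap ℚ K α ^ 2) ^ 2) / y ^ 2)
        (quarticC_equation_iff.mpr (by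
          have h := weierstrassC_equation_iff.mp h.1
          field_simp
          linear_combination -16 * algebraMap ℚ K α ^ 2 *
            (x - 6 * (1 + algebraMap ℚ K α ^ 2) ^ 2) ^ 3 * h))

lemma weierstrassToQuartic_quarticToWeierstrass (α : ℚ) [(weierstrassC α).IsElliptic] (K : Type)
    [Field K] [Algebra ℚ K] (P : (quarticC α).Point K) :
    weierstrassToQuartic α K (quarticToWeierstrass α K P) = P := by
  have := algebraRat.charZero K
  have hα := algebraMap_ne_zero_of_isElliptic K α
  have hd := algebraMap_sq_sub_ne_zero_of_isElliptic K α
  rcases P with ⟨x, y, h⟩ | ⟨v, h⟩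
  · have h' := quarticC_equation_iff.mp h
    by_cases hx : x = 0
    · subst hx
      by_cases hy : y = 2 * algebraMap ℚ K α
      · subst hy
        simp only [quarticToWeierstrass, dif_pos, if_pos]
        rfl
      · have hy' : y = -(2 * algebraMap ℚ K α) := by
          refine (sq_eq_sq_iff_eq_or_eq_neg.mp ?_).resolve_left hy
          linear_combination h'
        subst hy'
        simp only [quarticToWeierstrass, dif_pos, if_neg hy, weierstrassToQuartic]
    · -- If `Y = 0`, then `y + 2 α = ± α x²`, which forces `s² = 16 α⁴`.
      have hY : 4 * algebraMap ℚ K α * (y + 2 * algebraMap ℚ K α) -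
          (1 + algebraMap ℚ K α ^ 2) ^ 2 * x ^ 2 ≠ 0 := by
        intro h0
        apply hd
        have : x ^ 4 * ((9 * (1 + algebraMap ℚ K α ^ 2) ^ 2) ^ 2 -
            (36 * algebraMap ℚ K α ^ 2) ^ 2) = 0 := by
          linear_combination (1296 * algebraMap ℚ K α ^ 2 -
            81 * ((1 + algebraMap ℚ K α ^ 2) ^ 2 * x ^ 2 +
              4 * algebraMap ℚ K α * (y + 2 * algebraMap ℚ K α))) * h0 +
            1296 * algebraMap ℚ K α ^ 2 * h'
        exact (mul_eq_zero.mp this).resolve_left (pow_ne_zero _ hx)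
      simp only [quarticToWeierstrass, dif_neg hx, weierstrassToQuartic]
      have e₁ : (36 * algebraMap ℚ K α * (y + 2 * algebraMap ℚ K α) -
          3 * (1 + algebraMap ℚ K α ^ 2) ^ 2 * x ^ 2) / x ^ 2 -
          6 * (1 + algebraMap ℚ K α ^ 2) ^ 2 = 9 * (4 * algebraMap ℚ K α *
            (y + 2 * algebraMap ℚ K α) - (1 + algebraMap ℚ K α ^ 2) ^ 2 * x ^ 2) / x ^ 2 := by
        field_simp
        ring
      have e₂ : (36 * algebraMap ℚ K α * (y + 2 * algebraMap ℚ K α) -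
          3 * (1 + algebraMap ℚ K α ^ 2) ^ 2 * x ^ 2) / x ^ 2 +
          3 * (1 + algebraMap ℚ K α ^ 2) ^ 2 =
          36 * algebraMap ℚ K α * (y + 2 * algebraMap ℚ K α) / x ^ 2 := by
        field_simp
        ring
      rw [dif_neg (div_ne_zero (mul_ne_zero (mul_ne_zero (by norm_num) hα) hY)
        (pow_ne_zero _ hx))]
      simp only [QuarticCurve.Point.affine.injEq, e₁, e₂]
      generalize 4 * algebraMap ℚ K α * (y + 2 * algebraMap ℚ K α) -
          (1 + algebraMap ℚ K α ^ 2) ^ 2 * x ^ 2 = N at hY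
      constructor
      · field_simp
        ring
      · field_simp
        ring
  · have h' := quarticC_infinity_iff.mp h
    have hv : 36 * algebraMap ℚ K α * v - 3 * (1 + algebraMap ℚ K α ^ 2) ^ 2 ≠
        6 * (1 + algebraMap ℚ K α ^ 2) ^ 2 := by
      intro h0
      apply hd
      linear_combination 1296 * algebraMap ℚ K α ^ 2 * h' -
        (36 * algebraMap ℚ K α * v + 9 * (1 + algebraMap ℚ K α ^ 2) ^ 2) * h0
    simp only [quarticToWeierstrass, weierstrassToQuartic, dif_pos, dif_neg hv,
      QuarticCurve.Point.infinity.injEq]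
    field_simp
    ring

lemma quarticToWeierstrass_weierstrassToQuartic (α : ℚ) [(weierstrassC α).IsElliptic] (K : Type)
    [Field K] [Algebra ℚ K] (P : ((weierstrassC α)⁄K).toAffine.Point) :
    quarticToWeierstrass α K (weierstrassToQuartic α K P) = P := by
  have := algebraRat.charZero K
  have hα := algebraMap_ne_zero_of_isElliptic K α
  rcases P with _ | ⟨x, y, h⟩
  · simp only [quarticToWeierstrass, dif_pos, if_pos, weierstrassToQuartic]
    rfl
  · have h' := weierstrassC_equation_iff.mp h.1
    by_cases hy : y = 0
    · subst hy
      by_cases hx : x = 6 * (1 + algebraMap ℚ K α ^ 2) ^ 2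
      · subst hx
        have : ¬ -(2 * algebraMap ℚ K α) = 2 * algebraMap ℚ K α := by
          rw [neg_eq_iff_add_eq_zero, ← two_mul]
          exact mul_ne_zero two_ne_zero (mul_ne_zero two_ne_zero hα)
        simp only [weierstrassToQuartic, dif_pos, quarticToWeierstrass, if_neg this]
      · simp only [weierstrassToQuartic, dif_pos, dif_neg hx, quarticToWeierstrass,
          WeierstrassCurve.Affine.Point.some.injEq, and_true]
        field_simp
        ring
    · have hx : x - 6 * (1 + algebraMap ℚ K α ^ 2) ^ 2 ≠ 0 := by
        intro h0
        rw [h0, zero_mul] at h'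
        exact hy (pow_eq_zero_iff two_ne_zero |>.mp h')
      simp only [weierstrassToQuartic, dif_neg hy, quarticToWeierstrass]
      rw [dif_neg (div_ne_zero (mul_ne_zero (mul_ne_zero (by norm_num) hα) hx) hy)]
      simp only [WeierstrassCurve.Affine.Point.some.injEq]
      obtain ⟨T, rfl⟩ : ∃ T, x = T + 6 * (1 + algebraMap ℚ K α ^ 2) ^ 2 :=
        ⟨x - 6 * (1 + algebraMap ℚ K α ^ 2) ^ 2, by ring⟩
      simp only [add_sub_cancel_right] at hx ⊢
      constructor
      · field_simp
        ring
      · field_simp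
        ring

/-- The bijection between the points of the quartic and of its Weierstrass model over `K`. -/
noncomputable def quarticEquivWeierstrass (α : ℚ) [(weierstrassC α).IsElliptic] (K : Type)
    [Field K] [Algebra ℚ K] : (quarticC α).Point K ≃ ((weierstrassC α)⁄K).toAffine.Point where
  toFun := quarticToWeierstrass α K
  invFun := weierstrassToQuartic α K
  left_inv := weierstrassToQuartic_quarticToWeierstrass α K
  right_inv := quarticToWeierstrass_weierstrassToQuartic α K

end Isomorphism

/-! ### Regularity of the bijection and of its inverse -/

section Regularity
open MvPolynomial

/-- Homogeneous polynomials of degree `3` for `quarticToWeierstrass`: its generic formula,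
multiplied by `x³`. They have no common zero on the quartic except `(0, -2 α)`. -/
noncomputable def toWeierstrassChart (α : ℚ) : Fin 3 → MvPolynomial (Fin 3) ℚ :=
  ![(C (36 * α) * (X 1 + C (2 * α) * X 2 ^ 2) - C (3 * (1 + α ^ 2) ^ 2) * X 0 ^ 2) * X 0,
    (C (432 * α ^ 2) * (X 1 + C (2 * α) * X 2 ^ 2) - C (108 * α * (1 + α ^ 2) ^ 2) * X 0 ^ 2) * X 2,
    X 0 ^ 3]

/-- Homogeneous polynomials of degree `4` for `quarticToWeierstrass`, obtained from the generic
formula by `(y + 2 α) (y - 2 α) = x² (α² x² - s)` and multiplication by `(y - 2 α)²`. They do not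
vanish simultaneously where `y ≠ 2 α`. -/
noncomputable def toWeierstrassChart' (α : ℚ) : Fin 3 → MvPolynomial (Fin 3) ℚ :=
  ![C (36 * α) * ((C (α ^ 2) * X 0 ^ 2 - C ((1 + α ^ 2) ^ 2) * X 2 ^ 2) *
      (X 1 - C (2 * α) * X 2 ^ 2)) -
      C (3 * (1 + α ^ 2) ^ 2) * (X 1 - C (2 * α) * X 2 ^ 2) ^ 2,
    C (108 * α) * (X 0 * X 2 * (C (4 * α ^ 3) * (X 1 - C (2 * α) * X 2 ^ 2) -
      C ((1 + α ^ 2) ^ 2) * (C (α ^ 2) * X 0 ^ 2 - C ((1 + α ^ 2) ^ 2) * X 2 ^ 2))),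
    (X 1 - C (2 * α) * X 2 ^ 2) ^ 2]

lemma toWeierstrassChart_isWeightedHomogeneous (α : ℚ) (i : Fin 3) :
    (toWeierstrassChart α i).IsWeightedHomogeneous ![1, 2, 1] (3 * ![1, 1, 1] i) := by
  have h (j : Fin 3) := isWeightedHomogeneous_X ℚ ![1, 2, 1] j
  have h₁ : (X 1 + C (2 * α) * X 2 ^ 2 : MvPolynomial (Fin 3) ℚ).IsWeightedHomogeneous
      ![1, 2, 1] 2 := (h 1).add (((h 2).pow 2).C_mul _)
  fin_cases i
  · exact ((h₁.C_mul _).sub (((h 0).pow 2).C_mul _)).mul (h 0)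
  · exact ((h₁.C_mul _).sub (((h 0).pow 2).C_mul _)).mul (h 2)
  · exact (h 0).pow 3

lemma toWeierstrassChart'_isWeightedHomogeneous (α : ℚ) (i : Fin 3) :
    (toWeierstrassChart' α i).IsWeightedHomogeneous ![1, 2, 1] (4 * ![1, 1, 1] i) := by
  have h (j : Fin 3) := isWeightedHomogeneous_X ℚ ![1, 2, 1] j
  have h₁ : (X 1 - C (2 * α) * X 2 ^ 2 : MvPolynomial (Fin 3) ℚ).IsWeightedHomogeneous
      ![1, 2, 1] 2 := (h 1).sub (((h 2).pow 2).C_mul _)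
  have h₂ : (C (α ^ 2) * X 0 ^ 2 - C ((1 + α ^ 2) ^ 2) * X 2 ^ 2 :
      MvPolynomial (Fin 3) ℚ).IsWeightedHomogeneous ![1, 2, 1] 2 :=
    (((h 0).pow 2).C_mul _).sub (((h 2).pow 2).C_mul _)
  fin_cases i
  · exact ((h₂.mul h₁).C_mul _).sub ((h₁.pow 2).C_mul _)
  · exact (((h 0).mul (h 2)).mul ((h₁.C_mul _).sub (h₂.C_mul _))).C_mul _
  · exact h₁.pow 2

variable {α : ℚ} {K : Type} [Field K] [Algebra ℚ K]

lemma aeval_toWeierstrassChart (c : Fin 3 → K) (i : Fin 3) :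
    aeval c (toWeierstrassChart α i) =
      ![(36 * algebraMap ℚ K α * (c 1 + 2 * algebraMap ℚ K α * c 2 ^ 2) -
          3 * (1 + algebraMap ℚ K α ^ 2) ^ 2 * c 0 ^ 2) * c 0,
        (432 * algebraMap ℚ K α ^ 2 * (c 1 + 2 * algebraMap ℚ K α * c 2 ^ 2) -
          108 * algebraMap ℚ K α * (1 + algebraMap ℚ K α ^ 2) ^ 2 * c 0 ^ 2) * c 2,
        c 0 ^ 3] i := by
  fin_cases i <;>
  simp only [toWeierstrassChart, Fin.zero_eta, Fin.mk_one, Fin.reduceFinMk, Matrix.cons_val,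
    map_mul, map_add, map_sub, map_pow, aeval_X, algHom_C, map_one, map_ofNat]

lemma aeval_toWeierstrassChart' (c : Fin 3 → K) (i : Fin 3) :
    aeval c (toWeierstrassChart' α i) =
      ![36 * algebraMap ℚ K α * ((algebraMap ℚ K α ^ 2 * c 0 ^ 2 -
            (1 + algebraMap ℚ K α ^ 2) ^ 2 * c 2 ^ 2) * (c 1 - 2 * algebraMap ℚ K α * c 2 ^ 2)) -
          3 * (1 + algebraMap ℚ K α ^ 2) ^ 2 * (c 1 - 2 * algebraMap ℚ K α * c 2 ^ 2) ^ 2,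
        108 * algebraMap ℚ K α * (c 0 * c 2 *
          (4 * algebraMap ℚ K α ^ 3 * (c 1 - 2 * algebraMap ℚ K α * c 2 ^ 2) -
            (1 + algebraMap ℚ K α ^ 2) ^ 2 * (algebraMap ℚ K α ^ 2 * c 0 ^ 2 -
              (1 + algebraMap ℚ K α ^ 2) ^ 2 * c 2 ^ 2))),
        (c 1 - 2 * algebraMap ℚ K α * c 2 ^ 2) ^ 2] i := by
  fin_cases i <;>
  simp only [toWeierstrassChart', Fin.zero_eta, Fin.mk_one, Fin.reduceFinMk, Matrix.cons_val,
    map_mul, map_add, map_sub, map_pow, aeval_X, algHom_C, map_one, map_ofNat]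

lemma toWeierstrassChart_spec [(weierstrassC α).IsElliptic] (P : (quarticC α).Point K)
    (hP : ∃ i, aeval P.coords (toWeierstrassChart α i) ≠ 0) :
    ∃ t : K, t ≠ 0 ∧ ∀ i, aeval P.coords (toWeierstrassChart α i) =
      t ^ (![1, 1, 1] : Fin 3 → ℕ) i *
        WeierstrassCurve.projCoords (quarticToWeierstrass α K P) i := by
  have := algebraRat.charZero K
  have hα := algebraMap_ne_zero_of_isElliptic K α
  simp only [aeval_toWeierstrassChart, Fin.forall_fin_succ, Fin.exists_fin_succ] at hP ⊢
  rcases P with ⟨x, y, h⟩ | ⟨v, h⟩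
  · have h' := quarticC_equation_iff.mp h
    by_cases hx : x = 0
    · subst hx
      by_cases hy : y = 2 * algebraMap ℚ K α
      · subst hy
        refine ⟨1728 * algebraMap ℚ K α ^ 3, mul_ne_zero (by norm_num) (pow_ne_zero _ hα), ?_⟩
        simp [QuarticCurve.Point.coords, quarticToWeierstrass, WeierstrassCurve.projCoords]
        ring
      · have hy' : y = -(2 * algebraMap ℚ K α) := by
          refine (sq_eq_sq_iff_eq_or_eq_neg.mp ?_).resolve_left hy
          linear_combination h'
        subst hy'
        simp [QuarticCurve.Point.coords] at hP
    · refine ⟨x ^ 3, pow_ne_zero _ hx, ?_⟩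
      simp [QuarticCurve.Point.coords, quarticToWeierstrass, WeierstrassCurve.projCoords, hx]
      constructor
      · field_simp
      · field_simp
        ring
  · refine ⟨1, one_ne_zero, ?_⟩
    simp [QuarticCurve.Point.coords, quarticToWeierstrass, WeierstrassCurve.projCoords]

lemma toWeierstrassChart'_spec [(weierstrassC α).IsElliptic] (P : (quarticC α).Point K)
    (hP : ∃ i, aeval P.coords (toWeierstrassChart' α i) ≠ 0) :
    ∃ t : K, t ≠ 0 ∧ ∀ i, aeval P.coords (toWeierstrassChart' α i) =
      t ^ (![1, 1, 1] : Fin 3 → ℕ) i *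
        WeierstrassCurve.projCoords (quarticToWeierstrass α K P) i := by
  have := algebraRat.charZero K
  have hα := algebraMap_ne_zero_of_isElliptic K α
  simp only [aeval_toWeierstrassChart', Fin.forall_fin_succ, Fin.exists_fin_succ] at hP ⊢
  rcases P with ⟨x, y, h⟩ | ⟨v, h⟩
  · have h' := quarticC_equation_iff.mp h
    have hG : y - 2 * algebraMap ℚ K α ≠ 0 := by
      intro hG
      obtain rfl : y = 2 * algebraMap ℚ K α := sub_eq_zero.mp hG
      have : x * (algebraMap ℚ K α ^ 2 * x ^ 2 - (1 + algebraMap ℚ K α ^ 2) ^ 2) = 0 := by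
        rw [← pow_eq_zero_iff two_ne_zero]
        linear_combination -(algebraMap ℚ K α ^ 2 * x ^ 2 - (1 + algebraMap ℚ K α ^ 2) ^ 2) * h'
      simp [QuarticCurve.Point.coords] at hP this
      grind
    refine ⟨(y - 2 * algebraMap ℚ K α) ^ 2, pow_ne_zero _ hG, ?_⟩
    by_cases hx : x = 0
    · subst hx
      have hy : y ≠ 2 * algebraMap ℚ K α := sub_ne_zero.mp hG
      have hy' : y = -(2 * algebraMap ℚ K α) := by
        refine (sq_eq_sq_iff_eq_or_eq_neg.mp ?_).resolve_left hy
        linear_combination h'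
      subst hy'
      simp [QuarticCurve.Point.coords, quarticToWeierstrass, WeierstrassCurve.projCoords] at hy ⊢
      simp [hy]
      ring
    · clear hP
      simp [QuarticCurve.Point.coords, quarticToWeierstrass, WeierstrassCurve.projCoords,
        hx] at h' ⊢
      constructor
      · field_simp
        linear_combination -36 * (α : K) * (y - 2 * α) * h'
      · field_simp
        linear_combination (α : K) * ((1 + (α : K) ^ 2) ^ 2 * x ^ 2 - 4 * α * (y - 2 * α)) * h'
  · have h' := quarticC_infinity_iff.mp h
    refine ⟨v ^ 2, h' ▸ pow_ne_zero _ hα, ?_⟩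
    simp [QuarticCurve.Point.coords, quarticToWeierstrass, WeierstrassCurve.projCoords] at h' ⊢
    linear_combination (-36 * (α : K) * v) * h'

lemma exists_aeval_toWeierstrassChart_ne_zero [(weierstrassC α).IsElliptic]
    (P : (quarticC α).Point K) :
    (∃ i, aeval P.coords (toWeierstrassChart α i) ≠ 0) ∨
      ∃ i, aeval P.coords (toWeierstrassChart' α i) ≠ 0 := by
  have := algebraRat.charZero K
  have hα := algebraMap_ne_zero_of_isElliptic K α
  simp only [aeval_toWeierstrassChart, aeval_toWeierstrassChart']
  rcases P with ⟨x, y, h⟩ | ⟨v, h⟩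
  · by_cases hy : y - 2 * algebraMap ℚ K α = 0
    · left
      obtain rfl : y = 2 * algebraMap ℚ K α := sub_eq_zero.mp hy
      by_cases hx : x = 0
      · refine ⟨1, ?_⟩
        subst hx
        have e : 432 * algebraMap ℚ K α ^ 2 * (2 * algebraMap ℚ K α + 2 * algebraMap ℚ K α) ≠ 0 := by
          rw [← two_mul]
          exact mul_ne_zero (mul_ne_zero (by norm_num) (pow_ne_zero _ hα))
            (mul_ne_zero two_ne_zero (mul_ne_zero two_ne_zero hα))
        simpa [QuarticCurve.Point.coords] using e
      · refine ⟨2, ?_⟩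
        simpa [QuarticCurve.Point.coords] using hx
    · right
      refine ⟨2, ?_⟩
      simpa [QuarticCurve.Point.coords] using hy
  · left
    exact ⟨2, by simp [QuarticCurve.Point.coords]⟩

/-- Weighted homogeneous polynomials of degrees `1, 2, 1` for `weierstrassToQuartic`: its generic
formula, multiplied by `Y` and, in the second coordinate, simplified by the equation of the curve.
They have no common zero on the curve except the point of order two with `X = 6 s`. -/
noncomputable def toQuarticChart (α : ℚ) : Fin 3 → MvPolynomial (Fin 3) ℚ :=
  ![C (12 * α) * (X 0 - C (6 * (1 + α ^ 2) ^ 2) * X 2),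
    C (2 * α) * X 1 ^ 2 - C (36 * α) * ((X 0 - C (6 * (1 + α ^ 2) ^ 2) * X 2) *
      (C ((1 + α ^ 2) ^ 2) * (X 0 + C (3 * (1 + α ^ 2) ^ 2) * X 2) - C (144 * α ^ 4) * X 2)),
    X 1]

/-- Weighted homogeneous polynomials of degrees `2, 4, 2` for `weierstrassToQuartic`, obtained from
the generic formula by `(X - 6 s) / Y = Y / ((X + 3 s)² - (36 α²)²)`. They do not vanish
simultaneously at the point of order two with `X = 6 s`. -/
noncomputable def toQuarticChart' (α : ℚ) : Fin 3 → MvPolynomial (Fin 3) ℚ :=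
  ![C (12 * α) * (X 1 * X 2),
    C (4 * α) * ((X 0 + C (3 * (1 + α ^ 2) ^ 2) * X 2) * (X 0 - C (6 * (1 + α ^ 2) ^ 2) * X 2) *
      ((X 0 + C (3 * (1 + α ^ 2) ^ 2) * X 2) ^ 2 - C ((36 * α ^ 2) ^ 2) * X 2 ^ 2)) -
      C (2 * α) * ((X 0 + C (3 * (1 + α ^ 2) ^ 2) * X 2) ^ 2 -
        C ((36 * α ^ 2) ^ 2) * X 2 ^ 2) ^ 2,
    (X 0 + C (3 * (1 + α ^ 2) ^ 2) * X 2) ^ 2 - C ((36 * α ^ 2) ^ 2) * X 2 ^ 2]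

lemma toQuarticChart_isWeightedHomogeneous (α : ℚ) (i : Fin 3) :
    (toQuarticChart α i).IsWeightedHomogeneous ![1, 1, 1] (1 * ![1, 2, 1] i) := by
  have h (j : Fin 3) := isWeightedHomogeneous_X ℚ ![1, 1, 1] j
  have h₁ : (X 0 - C (6 * (1 + α ^ 2) ^ 2) * X 2 : MvPolynomial (Fin 3) ℚ).IsWeightedHomogeneous
      ![1, 1, 1] 1 := (h 0).sub ((h 2).C_mul _)
  have h₂ : (X 0 + C (3 * (1 + α ^ 2) ^ 2) * X 2 : MvPolynomial (Fin 3) ℚ).IsWeightedHomogeneous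
      ![1, 1, 1] 1 := (h 0).add ((h 2).C_mul _)
  fin_cases i
  · exact h₁.C_mul _
  · exact (((h 1).pow 2).C_mul _).sub ((h₁.mul ((h₂.C_mul _).sub ((h 2).C_mul _))).C_mul _)
  · exact h 1

lemma toQuarticChart'_isWeightedHomogeneous (α : ℚ) (i : Fin 3) :
    (toQuarticChart' α i).IsWeightedHomogeneous ![1, 1, 1] (2 * ![1, 2, 1] i) := by
  have h (j : Fin 3) := isWeightedHomogeneous_X ℚ ![1, 1, 1] j
  have h₁ : (X 0 - C (6 * (1 + α ^ 2) ^ 2) * X 2 : MvPolynomial (Fin 3) ℚ).IsWeightedHomogeneous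
      ![1, 1, 1] 1 := (h 0).sub ((h 2).C_mul _)
  have h₂ : (X 0 + C (3 * (1 + α ^ 2) ^ 2) * X 2 : MvPolynomial (Fin 3) ℚ).IsWeightedHomogeneous
      ![1, 1, 1] 1 := (h 0).add ((h 2).C_mul _)
  have h₃ : ((X 0 + C (3 * (1 + α ^ 2) ^ 2) * X 2) ^ 2 - C ((36 * α ^ 2) ^ 2) * X 2 ^ 2 :
      MvPolynomial (Fin 3) ℚ).IsWeightedHomogeneous ![1, 1, 1] 2 :=
    (h₂.pow 2).sub (((h 2).pow 2).C_mul _)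
  fin_cases i
  · exact ((h 1).mul (h 2)).C_mul _
  · exact (((h₂.mul h₁).mul h₃).C_mul _).sub ((h₃.pow 2).C_mul _)
  · exact h₃

lemma aeval_toQuarticChart (c : Fin 3 → K) (i : Fin 3) :
    aeval c (toQuarticChart α i) =
      ![12 * algebraMap ℚ K α * (c 0 - 6 * (1 + algebraMap ℚ K α ^ 2) ^ 2 * c 2),
        2 * algebraMap ℚ K α * c 1 ^ 2 - 36 * algebraMap ℚ K α *
          ((c 0 - 6 * (1 + algebraMap ℚ K α ^ 2) ^ 2 * c 2) *
            ((1 + algebraMap ℚ K α ^ 2) ^ 2 * (c 0 + 3 * (1 + algebraMap ℚ K α ^ 2) ^ 2 * c 2) -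
              144 * algebraMap ℚ K α ^ 4 * c 2)),
        c 1] i := by
  fin_cases i <;>
  simp only [toQuarticChart, Fin.zero_eta, Fin.mk_one, Fin.reduceFinMk, Matrix.cons_val,
    map_mul, map_add, map_sub, map_pow, aeval_X, algHom_C, map_one, map_ofNat]

lemma aeval_toQuarticChart' (c : Fin 3 → K) (i : Fin 3) :
    aeval c (toQuarticChart' α i) =
      ![12 * algebraMap ℚ K α * (c 1 * c 2),
        4 * algebraMap ℚ K α * ((c 0 + 3 * (1 + algebraMap ℚ K α ^ 2) ^ 2 * c 2) *
          (c 0 - 6 * (1 + algebraMap ℚ K α ^ 2) ^ 2 * c 2) *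
          ((c 0 + 3 * (1 + algebraMap ℚ K α ^ 2) ^ 2 * c 2) ^ 2 -
            (36 * algebraMap ℚ K α ^ 2) ^ 2 * c 2 ^ 2)) -
          2 * algebraMap ℚ K α * ((c 0 + 3 * (1 + algebraMap ℚ K α ^ 2) ^ 2 * c 2) ^ 2 -
            (36 * algebraMap ℚ K α ^ 2) ^ 2 * c 2 ^ 2) ^ 2,
        (c 0 + 3 * (1 + algebraMap ℚ K α ^ 2) ^ 2 * c 2) ^ 2 -
          (36 * algebraMap ℚ K α ^ 2) ^ 2 * c 2 ^ 2] i := by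
  fin_cases i <;>
  simp only [toQuarticChart', Fin.zero_eta, Fin.mk_one, Fin.reduceFinMk, Matrix.cons_val,
    map_mul, map_add, map_sub, map_pow, aeval_X, algHom_C, map_one, map_ofNat]

lemma toQuarticChart_spec [(weierstrassC α).IsElliptic] (P : ((weierstrassC α)⁄K).toAffine.Point)
    (hP : ∃ i, aeval (WeierstrassCurve.projCoords P) (toQuarticChart α i) ≠ 0) :
    ∃ t : K, t ≠ 0 ∧ ∀ i, aeval (WeierstrassCurve.projCoords P) (toQuarticChart α i) =
      t ^ (![1, 2, 1] : Fin 3 → ℕ) i * (weierstrassToQuartic α K P).coords i := by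
  have := algebraRat.charZero K
  have hα := algebraMap_ne_zero_of_isElliptic K α
  simp only [aeval_toQuarticChart, Fin.forall_fin_succ, Fin.exists_fin_succ] at hP ⊢
  rcases P with _ | ⟨x, y, h⟩
  · refine ⟨1, one_ne_zero, ?_⟩
    simp [WeierstrassCurve.projCoords, QuarticCurve.Point.coords, weierstrassToQuartic]
  · have h' := weierstrassC_equation_iff.mp h.1
    by_cases hy : y = 0
    · subst hy
      have hx : x - 6 * (1 + algebraMap ℚ K α ^ 2) ^ 2 ≠ 0 := by
        intro hx
        simp [WeierstrassCurve.projCoords] at hP hx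
        simp [hx] at hP
      refine ⟨12 * algebraMap ℚ K α * (x - 6 * (1 + algebraMap ℚ K α ^ 2) ^ 2),
        mul_ne_zero (mul_ne_zero (by norm_num) hα) hx, ?_⟩
      rw [zero_pow two_ne_zero, zero_eq_mul, or_iff_right hx] at h'
      simp only [weierstrassToQuartic, dif_pos, dif_neg (sub_ne_zero.mp hx)]
      simp [WeierstrassCurve.projCoords, QuarticCurve.Point.coords] at h' ⊢
      clear hP
      field_simp
      linear_combination -144 * (α : K) * (x - 6 * (1 + (α : K) ^ 2) ^ 2) * h'
    · refine ⟨y, hy, ?_⟩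
      clear hP
      simp only [weierstrassToQuartic, dif_neg hy]
      simp [WeierstrassCurve.projCoords, QuarticCurve.Point.coords] at h' ⊢
      constructor
      · field_simp
      · field_simp
        linear_combination 4 * (α : K) * h'

lemma toQuarticChart'_spec [(weierstrassC α).IsElliptic] (P : ((weierstrassC α)⁄K).toAffine.Point)
    (hP : ∃ i, aeval (WeierstrassCurve.projCoords P) (toQuarticChart' α i) ≠ 0) :
    ∃ t : K, t ≠ 0 ∧ ∀ i, aeval (WeierstrassCurve.projCoords P) (toQuarticChart' α i) =
      t ^ (![1, 2, 1] : Fin 3 → ℕ) i * (weierstrassToQuartic α K P).coords i := by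
  have := algebraRat.charZero K
  have hα := algebraMap_ne_zero_of_isElliptic K α
  simp only [aeval_toQuarticChart', Fin.forall_fin_succ, Fin.exists_fin_succ] at hP ⊢
  rcases P with _ | ⟨x, y, h⟩
  · simp [WeierstrassCurve.projCoords] at hP
  · have h' := weierstrassC_equation_iff.mp h.1
    have hD : (x + 3 * (1 + algebraMap ℚ K α ^ 2) ^ 2) ^ 2 - (36 * algebraMap ℚ K α ^ 2) ^ 2 ≠ 0 := by
      intro hD
      rw [hD, mul_zero, pow_eq_zero_iff two_ne_zero] at h'
      simp [WeierstrassCurve.projCoords] at hP hD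
      simp [h', hD] at hP
    refine ⟨_, hD, ?_⟩
    by_cases hy : y = 0
    · subst hy
      rw [zero_pow two_ne_zero, zero_eq_mul, or_iff_left hD, sub_eq_zero] at h'
      simp only [weierstrassToQuartic, dif_pos, dif_pos h']
      simp [WeierstrassCurve.projCoords, QuarticCurve.Point.coords] at h' ⊢
      rw [h']
      ring
    · clear hP
      simp only [weierstrassToQuartic, dif_neg hy]
      simp [WeierstrassCurve.projCoords, QuarticCurve.Point.coords] at h' ⊢
      constructor
      · field_simp
        linear_combination (α : K) * h'
      · field_simp
        linear_combination 4 * α * (x + 3 * (1 + (α : K) ^ 2) ^ 2) * (x - 6 * (1 + (α : K) ^ 2) ^ 2) *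
          ((x + 3 * (1 + (α : K) ^ 2) ^ 2) ^ 2 - (36 * (α : K) ^ 2) ^ 2) * h'

lemma exists_aeval_toQuarticChart_ne_zero [(weierstrassC α).IsElliptic]
    (P : ((weierstrassC α)⁄K).toAffine.Point) :
    (∃ i, aeval (WeierstrassCurve.projCoords P) (toQuarticChart α i) ≠ 0) ∨
      ∃ i, aeval (WeierstrassCurve.projCoords P) (toQuarticChart' α i) ≠ 0 := by
  have := algebraRat.charZero K
  have hα := algebraMap_ne_zero_of_isElliptic K α
  have hd := algebraMap_sq_sub_ne_zero_of_isElliptic K α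
  simp only [aeval_toQuarticChart, aeval_toQuarticChart']
  rcases P with _ | ⟨x, y, h⟩
  · left
    exact ⟨2, by simp [WeierstrassCurve.projCoords]⟩
  · by_cases hx : x - 6 * (1 + algebraMap ℚ K α ^ 2) ^ 2 = 0
    · right
      refine ⟨2, ?_⟩
      obtain rfl := sub_eq_zero.mp hx
      simp only [WeierstrassCurve.projCoords, Matrix.cons_val, mul_one, one_pow]
      convert hd using 2
      ring
    · left
      refine ⟨0, ?_⟩
      simp only [WeierstrassCurve.projCoords, Matrix.cons_val, mul_one]
      exact mul_ne_zero (mul_ne_zero (by norm_num) hα) hx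

/-- The isomorphism over `ℚ` from the quartic onto its Weierstrass model. -/
noncomputable def quarticIsomWeierstrass (α : ℚ) [(weierstrassC α).IsElliptic] :
    (quarticC α).Isom (weierstrassC α) where
  toEquiv K _ _ := quarticEquivWeierstrass α K
  regular K _ _ P := by
    rcases exists_aeval_toWeierstrassChart_ne_zero P with h | h
    · exact ⟨3, toWeierstrassChart α, toWeierstrassChart_isWeightedHomogeneous α, h,
        fun L _ _ R => toWeierstrassChart_spec R⟩
    · exact ⟨4, toWeierstrassChart' α, toWeierstrassChart'_isWeightedHomogeneous α, h,
        fun L _ _ R => toWeierstrassChart'_spec R⟩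
  regular_symm K _ _ P := by
    rcases exists_aeval_toQuarticChart_ne_zero P with h | h
    · exact ⟨1, toQuarticChart α, toQuarticChart_isWeightedHomogeneous α, h,
        fun L _ _ R => toQuarticChart_spec R⟩
    · exact ⟨2, toQuarticChart' α, toQuarticChart'_isWeightedHomogeneous α, h,
        fun L _ _ R => toQuarticChart'_spec R⟩

end Regularity

/-! ### Infinite order of the given point, smoothness, and rank -/

section Application

instance (α : ℚ) (K : Type) [Field K] [Algebra ℚ K] : ((weierstrassC α)⁄K).IsShortNF :=
  ⟨map_zero _, map_zero _, map_zero _⟩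

lemma pointX_inv {α : ℚ} (h0 : α ≠ 0) : pointX α⁻¹ = pointX α / α ^ 4 := by
  simp only [pointX]
  field_simp
  ring

lemma weierstrassC_inv_a₄ {α : ℚ} (h0 : α ≠ 0) :
    (weierstrassC α⁻¹).a₄ = (weierstrassC α).a₄ / α ^ 8 := by
  simp only [weierstrassC]
  field_simp
  ring

lemma weierstrassC_inv_a₆ {α : ℚ} (h0 : α ≠ 0) :
    (weierstrassC α⁻¹).a₆ = (weierstrassC α).a₆ / α ^ 12 := by
  simp only [weierstrassC]
  field_simp
  ring

lemma natCast_div_three_mem {p : ℕ} [hp : Fact p.Prime] :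
    (p : ℚ) / 3 ∈ (Rat.padicValuation p).integer := by
  by_cases h3 : p = 3
  · subst h3
    norm_num
  · have := inv_natCast_mem_padicValuation_integer (p := p) (n := 3)
      (fun h => h3 ((Nat.prime_dvd_prime_iff_eq hp.out Nat.prime_three).mp h))
    exact mul_mem (natCast_mem _ _) this

/-- For `α = p c` with `c` integral at `p`, write `E = 1 + α²` and
`U = (3 + 12 α² - 22 α⁴ + 12 α⁶ + 3 α⁸) / 3`. Both are units at `p` (also for `p = 3`), and
`pointX α = 9 E² U / (4 α⁴)`, so that `a₄ / X²` and `a₆ / X³` are `-16 α⁸ / 3` and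
`-128 α¹² / 27` times integral elements. -/
lemma exists_div_pointX_pow_eq {p : ℕ} [Fact p.Prime] {c : ℚ}
    (hc : c ∈ (Rat.padicValuation p).integer) (hc0 : c ≠ 0) :
    pointX (p * c) ≠ 0 ∧
    (∃ a ∈ (Rat.padicValuation p).integer,
      (weierstrassC (p * c)).a₄ / pointX (p * c) ^ 2 = p ^ 2 * a) ∧
    ∃ b ∈ (Rat.padicValuation p).integer,
      (weierstrassC (p * c)).a₆ / pointX (p * c) ^ 3 = p ^ 2 * b := by
  have hk := natCast_div_three_mem (p := p)
  set R := (Rat.padicValuation p).integer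
  have hp : (p : ℚ) ∈ R := natCast_mem R p
  have hp0 : (p : ℚ) ≠ 0 := Nat.cast_ne_zero.mpr (Fact.out : p.Prime).ne_zero
  -- Denominators `3` are absorbed by `k = p / 3`, which is integral for every prime `p`.
  set k : ℚ := p / 3 with hk3
  have hpk : (p : ℚ) = 3 * k := by rw [hk3]; ring
  have hk0 : k ≠ 0 := by intro h; exact hp0 (by rw [hpk, h, mul_zero])
  obtain ⟨hE0, hE⟩ := inv_one_add_mem_padicValuation_integer (p := p) (r := p * c ^ 2)
    (R.mul_mem hp (R.pow_mem hc 2))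
  obtain ⟨hU0, hU⟩ := inv_one_add_mem_padicValuation_integer (p := p)
    (r := 4 * (p * c ^ 2) - 22 * (k * (p ^ 2 * c ^ 4)) + 4 * (p ^ 5 * c ^ 6) + p ^ 7 * c ^ 8) (by
      have h4 : (4 : ℚ) ∈ R := ofNat_mem R 4
      have h22 : (22 : ℚ) ∈ R := ofNat_mem R 22
      apply_rules [R.add_mem, R.sub_mem, R.mul_mem, R.pow_mem])
  have hER : 1 + (p : ℚ) * (p * c ^ 2) ∈ R := by
    have h1 := R.one_mem
    apply_rules [R.add_mem, R.mul_mem, R.pow_mem]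
  set E := 1 + (p : ℚ) * (p * c ^ 2) with hE'
  set U := 1 + (p : ℚ) * (4 * (p * c ^ 2) - 22 * (k * (p ^ 2 * c ^ 4)) + 4 * (p ^ 5 * c ^ 6) +
    p ^ 7 * c ^ 8) with hU'
  have hX : pointX (p * c) = 9 / (4 * (p * c) ^ 4) * E ^ 2 * U := by
    rw [pointX, hE', hU', hpk]
    field_simp
    ring
  refine ⟨?_, ⟨-48 * (p ^ 4 * k ^ 2 * c ^ 8 * (48 * (p * c) ^ 4 + E ^ 4) * E⁻¹ ^ 4 * U⁻¹ ^ 2), ?_, ?_⟩,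
    ⟨-128 * (p ^ 7 * k ^ 3 * c ^ 12 * (E ^ 4 - 144 * (p * c) ^ 4) * E⁻¹ ^ 4 * U⁻¹ ^ 3), ?_, ?_⟩⟩
  · rw [hX]
    positivity
  · have h48 : (48 : ℚ) ∈ R := ofNat_mem R 48
    rw [neg_mul]
    apply_rules [R.neg_mem, R.add_mem, R.mul_mem, R.pow_mem]
  · have : (weierstrassC (p * c)).a₄ = -27 * (48 * (p * c) ^ 4 + E ^ 4) := by
      rw [hE', weierstrassC]
      ring
    rw [hX, this]
    clear_value E U
    rw [hpk]
    field_simp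
    ring
  · have h128 : (128 : ℚ) ∈ R := ofNat_mem R 128
    have h144 : (144 : ℚ) ∈ R := ofNat_mem R 144
    rw [neg_mul]
    apply_rules [R.neg_mem, R.sub_mem, R.mul_mem, R.pow_mem]
  · have : (weierstrassC (p * c)).a₆ = -54 * E ^ 2 * (E ^ 4 - 144 * (p * c) ^ 4) := by
      rw [hE', weierstrassC]
      ring
    rw [hX, this]
    clear_value E U
    rw [hpk]
    field_simp
    ring

/-- Some prime divides `α` or `α⁻¹`. -/
lemma exists_prime_dvd {α : ℚ} (h1 : α ≠ 1) (hneg1 : α ≠ -1) :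
    ∃ p : ℕ, ∃ _ : Fact p.Prime, ∃ c ∈ (Rat.padicValuation p).integer, α = p * c ∨ α⁻¹ = p * c := by
  by_cases hnum : α.num.natAbs = 1
  · have hden : α.den ≠ 1 := by
      intro hden
      rcases Int.natAbs_eq_iff.mp hnum with h | h
      · exact h1 (by rw [← α.num_div_den, h, hden]; norm_num)
      · exact hneg1 (by rw [← α.num_div_den, h, hden]; norm_num)
    obtain ⟨p, hp, m, hm⟩ := Nat.exists_prime_and_dvd hden
    have : Fact p.Prime := ⟨hp⟩
    have hα : α⁻¹ = α.den * α.num := by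
      nth_rw 1 [← α.num_div_den]
      rcases Int.natAbs_eq_iff.mp hnum with h | h <;> simp [h, div_eq_mul_inv]
    refine ⟨p, this, m * α.num, mul_mem (natCast_mem _ m) (intCast_mem _ _), Or.inr ?_⟩
    rw [hα, hm]
    push_cast
    ring
  · obtain ⟨p, hp, hd⟩ := Nat.exists_prime_and_dvd hnum
    have : Fact p.Prime := ⟨hp⟩
    obtain ⟨m, hm⟩ := Int.natCast_dvd.mpr hd
    have hden : ¬ p ∣ α.den := fun h => Nat.not_coprime_of_dvd_of_dvd hp.one_lt hd h α.reduced
    refine ⟨p, this, m * (α.den : ℚ)⁻¹, mul_mem (intCast_mem _ m)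
      (inv_natCast_mem_padicValuation_integer hden), Or.inl ?_⟩
    nth_rw 1 [← α.num_div_den]
    rw [hm, div_eq_mul_inv]
    push_cast
    ring

lemma addOrderOf_point_eq_zero {α : ℚ} (h0 : α ≠ 0) (h1 : α ≠ 1) (hneg1 : α ≠ -1)
    (h : ((weierstrassC α)⁄ℚ).toAffine.Nonsingular (pointX α) (pointY α)) :
    addOrderOf (WeierstrassCurve.Affine.Point.some (pointX α) (pointY α) h) = 0 := by
  obtain ⟨p, hp, c, hc, hα⟩ := exists_prime_dvd h1 hneg1
  -- The curve and the point at `α⁻¹` are those at `α`, scaled, so `α` and `α⁻¹` play the same role.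
  have key : pointX α ≠ 0 ∧
    (∃ a ∈ (Rat.padicValuation p).integer, (weierstrassC α).a₄ / pointX α ^ 2 = p ^ 2 * a) ∧
    ∃ b ∈ (Rat.padicValuation p).integer, (weierstrassC α).a₆ / pointX α ^ 3 = p ^ 2 * b := by
    rcases hα with rfl | hα
    · exact exists_div_pointX_pow_eq hc (right_ne_zero_of_mul h0)
    · have := exists_div_pointX_pow_eq hc (right_ne_zero_of_mul (hα ▸ inv_ne_zero h0))
      rw [← hα, pointX_inv h0, weierstrassC_inv_a₄ h0, weierstrassC_inv_a₆ h0] at this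
      obtain ⟨h1, ⟨a, ha, h2⟩, b, hb, h3⟩ := this
      have hX : pointX α ≠ 0 := fun h => h1 (by rw [h, zero_div])
      refine ⟨hX, ⟨a, ha, ?_⟩, b, hb, ?_⟩
      · rw [← h2]
        field_simp
      · rw [← h3]
        field_simp
  obtain ⟨hX, ⟨a, ha, h2⟩, b, hb, h3⟩ := key
  exact WeierstrassCurve.Affine.addOrderOf_eq_zero_of_div_mem hp.out.one_lt
    (fun r => inv_one_add_mem_padicValuation_integer)
    (fun n => inv_natCast_mem_padicValuation_integer) h hX ha hb h2 h3

lemma quarticC_isSmooth (α : ℚ) [(weierstrassC α).IsElliptic] : (quarticC α).IsSmooth := by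
  intro K _ _
  have := algebraRat.charZero K
  have hα := algebraMap_ne_zero_of_isElliptic K α
  have hd := algebraMap_sq_sub_ne_zero_of_isElliptic K α
  simp only [quarticC, map_zero, map_mul, map_neg, map_add, map_pow, map_one, map_ofNat]
  generalize algebraMap ℚ K α = β at *
  constructor
  · intro x y h
    by_contra! h'
    obtain ⟨hy, hx⟩ := h'
    have hy : y = 0 := by simpa using hy
    rw [hy] at h
    have hx : x * (2 * (β ^ 2 * x ^ 2) - (1 + β ^ 2) ^ 2) = 0 := by
      apply mul_left_cancel₀ (two_ne_zero (α := K))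
      linear_combination hx
    rcases mul_eq_zero.mp hx with rfl | hx
    · apply hα
      rw [← pow_eq_zero_iff two_ne_zero]
      apply mul_left_cancel₀ (show (4 : K) ≠ 0 by norm_num)
      linear_combination -h
    · -- `4 α² (α² x⁴ - s x² + 4 α²) = (2 α² x² - s)² - (s² - 16 α⁴)`
      apply hd
      linear_combination 81 * (2 * (β ^ 2 * x ^ 2) - (1 + β ^ 2) ^ 2) * hx + 324 * β ^ 2 * h
  · intro x y h
    by_contra! h'
    obtain ⟨hy, hx⟩ := h'
    have hy : y = 0 := by simpa using hy
    rw [hy] at h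
    have hx : x * (8 * (β ^ 2 * x ^ 2) - (1 + β ^ 2) ^ 2) = 0 := by
      apply mul_left_cancel₀ (two_ne_zero (α := K))
      linear_combination hx
    rcases mul_eq_zero.mp hx with rfl | hx
    · apply hα
      rw [← pow_eq_zero_iff two_ne_zero]
      linear_combination -h
    · apply hd
      linear_combination 81 * (8 * (β ^ 2 * x ^ 2) - (1 + β ^ 2) ^ 2) * hx + 1296 * β ^ 2 * h

lemma equation_point {α : ℚ} (h0 : α ≠ 0) :
    ((weierstrassC α)⁄ℚ).toAffine.Equation (pointX α) (pointY α) := by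
  rw [weierstrassC_equation_iff]
  simp only [pointX, pointY, eq_ratCast, Rat.cast_id]
  field_simp
  ring

lemma QuarticCurve.EllipticStructure.rank_pos {Q : QuarticCurve} {O : Q.Point ℚ}
    (S : Q.EllipticStructure O) (P : (S.W⁄ℚ).toAffine.Point) (hP : addOrderOf P = 0) :
    0 < S.rank := by
  let e : S.MordellWeil ≃+ (S.W⁄ℚ).toAffine.Point := (S.iso.toEquiv ℚ).addEquiv
  rw [rank, pos_iff_ne_zero, ne_eq, rank_eq_zero_iff]
  push Not
  refine ⟨e.symm P, fun n hn h => ?_⟩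
  rw [← map_zsmul, map_eq_zero_iff _ e.symm.injective] at h
  rw [addOrderOf_eq_zero_iff, isOfFinAddOrder_iff_zsmul_eq_zero] at hP
  exact hP ⟨n, hn, h⟩

end Application

theorem mainTheorem5 (α : ℚ) (h0 : α ≠ 0) (h1 : α ≠ 1) (hneg1 : α ≠ -1) :
    (quarticC α).IsSmooth ∧
    ∃ S : (quarticC α).EllipticStructure (basePointC α),
      S.W = weierstrassC α ∧
      0 < S.rank ∧
      ∃ h : ((weierstrassC α)⁄ℚ).toAffine.Nonsingular (pointX α) (pointY α),
        addOrderOf (WeierstrassCurve.Affine.Point.some (pointX α) (pointY α) h) = 0 := by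
  have hell := weierstrassC_isElliptic h0 h1 hneg1
  let S : (quarticC α).EllipticStructure (basePointC α) :=
    { W := weierstrassC α
      isElliptic := hell
      iso := quarticIsomWeierstrass α
      map_origin := by
        show quarticToWeierstrass α ℚ (basePointC α) = 0
        simp [quarticToWeierstrass, basePointC] }
  have hns : ((weierstrassC α)⁄ℚ).toAffine.Nonsingular (pointX α) (pointY α) :=
    weierstrassC_nonsingular (weierstrassC_equation_iff.mp (equation_point h0))
  have hord := addOrderOf_point_eq_zero h0 h1 hneg1 hns
  exact ⟨quarticC_isSmooth α, S, rfl, S.rank_pos _ hord, hns, hord⟩
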